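/- Let $A$ be an $n\times n$ complex matrix ($n\ge 1$) that is symmetric ($A=A^{T}$) and banded with bandwidth $w\ge 0$, i.e. $A_{ij}=0$ whenever $|i-j|>w$. Let $s=(s_1,\dots,s_n)$ be a vector of positive integers, put $c:=\max_i s_i$, and let $A_s$ be the symmetric matrix obtained from $A$ by repeating the $i$-th row and column $s_i$ times. The loop hafnian of a symmetric matrix $B$ with rows and columns indexed by a finite set $V$ is $\operatorname{lhaf}(B)=\sum_{\pi}\prod_{ij\in\pi}B_{ij}$, where $\pi$ ranges over the perfect matchings of the complete graph with loops on $V$ (sets of edges and loops such that every vertex lies on exactly one of them). Then $\operatorname{lhaf}(A_s)$ can be computed from $(n,w,s,A)$ in time $O^{*}\bigl(n\,(2c+2)^{2w+1}\bigr)$. Precisely: there are one program for a unit-cost random access machine with exact complex arithmetic (the operations $+,-,\times,\div$ on complex numbers, addition, truncated subtraction and comparison of natural numbers, indirect addressing and jumps; each executed instruction costs one unit of time) and absolute constants $K,k\in\mathbb N$ such that, for all $n$, $w$, $A$ and $s$ as above, the program started on input $(n,w,s,A)$, with the entries of $A$ and $s$ stored in memory, halts with output $\operatorname{lhaf}(A_s)$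 after at most $$K\cdot n\,(2c+2)^{2w+1}\cdot\bigl\lfloor\log_2\bigl((2c+2)^{2w+1}\bigr)\bigr\rfloor^{k}$$ steps. -/

import Mathlib

namespace LoopHaf

/-- `A i j = 0` whenever `|i - j| > w`. -/
def IsBanded {n : ℕ} (A : Matrix (Fin n) (Fin n) ℂ) (w : ℕ) : Prop :=
  ∀ i j : Fin n, (w : ℤ) < |(i : ℤ) - (j : ℤ)| → A i j = 0

/-- The perfect matchings of the complete graph with loops on `V`: the sets of edges (unordered
pairs of vertices, a loop being the pair `s(v, v)`) such that every vertex lies on exactly one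
edge of the set. -/
def perfectMatchings (V : Type*) [Fintype V] [DecidableEq V] : Finset (Finset (Sym2 V)) :=
  Finset.univ.filter fun π => ∀ v : V, (π.filter fun e => v ∈ e).card = 1

/-- The weight `A i j` of the edge `ij`. -/
def edgeWeight {V : Type*} (A : Matrix V V ℂ) (hA : A.IsSymm) : Sym2 V → ℂ :=
  Sym2.lift ⟨fun i j => A i j, fun i j => hA.apply j i⟩

/-- The loop hafnian of a symmetric matrix. -/
def lhaf {V : Type*} [Fintype V] [DecidableEq V] (A : Matrix V V ℂ) (hA : A.IsSymm) : ℂ :=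
  ∑ π ∈ perfectMatchings V, ∏ e ∈ π, edgeWeight A hA e

/-- `A` with its `i`-th row and column repeated `s i` times; the index `⟨i, l⟩` is the `l`-th
copy of `i`. -/
def repeated {n : ℕ} (A : Matrix (Fin n) (Fin n) ℂ) (s : Fin n → ℕ) :
    Matrix (Σ i : Fin n, Fin (s i)) (Σ i : Fin n, Fin (s i)) ℂ :=
  A.submatrix Sigma.fst Sigma.fst

theorem repeated_isSymm {n : ℕ} {A : Matrix (Fin n) (Fin n) ℂ} (hA : A.IsSymm)
    (s : Fin n → ℕ) : (repeated A s).IsSymm :=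
  hA.submatrix Sigma.fst

/-! A unit-cost random access machine with exact complex arithmetic. It has index registers and an
index memory, which hold natural numbers, and scalar registers and a scalar memory, which hold
complex numbers. Memory cells are addressed indirectly, through an index register. The only
operations on natural numbers are addition and (truncated) subtraction, and only comparisons of
natural numbers can influence the flow of control. -/

inductive Instr where
  /-- index register `d` gets the constant `k` -/
  | iconst (d k : ℕ)
  /-- `d := a + b` on index registers -/
  | iadd (d a b : ℕ)
  /-- `d := a - b` on index registers, or `0` if `a < b` -/
  | isub (d a b : ℕ)
  /-- index register `d` gets the index memory cell whose address is in index register `a` -/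
  | iload (d a : ℕ)
  /-- the index memory cell whose address is in index register `a` gets index register `b` -/
  | istore (a b : ℕ)
  /-- scalar register `d` gets the constant `k` -/
  | cconst (d k : ℕ)
  /-- `d := a + b` on scalar registers -/
  | cadd (d a b : ℕ)
  /-- `d := a - b` on scalar registers -/
  | csub (d a b : ℕ)
  /-- `d := a * b` on scalar registers -/
  | cmul (d a b : ℕ)
  /-- `d := a / b` on scalar registers; the machine crashes if `b` holds `0` -/
  | cdiv (d a b : ℕ)
  /-- scalar register `d` gets the scalar memory cell whose address is in index register `a` -/
  | cload (d a : ℕ)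
  /-- the scalar memory cell whose address is in index register `a` gets scalar register `b` -/
  | cstore (a b : ℕ)
  /-- continue at line `l` if index register `a` holds less than index register `b` -/
  | jlt (a b l : ℕ)
  /-- continue at line `l` -/
  | jump (l : ℕ)

/-- A program is a finite list of instructions, with lines numbered from `0`. -/
abbrev Program := List Instr

structure Config where
  /-- the line to be executed next -/
  pc : ℕ
  ireg : ℕ → ℕ
  imem : ℕ → ℕ
  creg : ℕ → ℂ
  cmem : ℕ → ℂ

open Classical in
/-- The effect of one instruction; `none` is a crash. -/
noncomputable def Instr.exec (c : Config) : Instr → Option Config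
  | .iconst d k => some { c with pc := c.pc + 1, ireg := Function.update c.ireg d k }
  | .iadd d a b =>
      some { c with pc := c.pc + 1, ireg := Function.update c.ireg d (c.ireg a + c.ireg b) }
  | .isub d a b =>
      some { c with pc := c.pc + 1, ireg := Function.update c.ireg d (c.ireg a - c.ireg b) }
  | .iload d a =>
      some { c with pc := c.pc + 1, ireg := Function.update c.ireg d (c.imem (c.ireg a)) }
  | .istore a b =>
      some { c with pc := c.pc + 1, imem := Function.update c.imem (c.ireg a) (c.ireg b) }
  | .cconst d k => some { c with pc := c.pc + 1, creg := Function.update c.creg d (k : ℂ) }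
  | .cadd d a b =>
      some { c with pc := c.pc + 1, creg := Function.update c.creg d (c.creg a + c.creg b) }
  | .csub d a b =>
      some { c with pc := c.pc + 1, creg := Function.update c.creg d (c.creg a - c.creg b) }
  | .cmul d a b =>
      some { c with pc := c.pc + 1, creg := Function.update c.creg d (c.creg a * c.creg b) }
  | .cdiv d a b =>
      if c.creg b = 0 then none
      else some { c with pc := c.pc + 1, creg := Function.update c.creg d (c.creg a / c.creg b) }
  | .cload d a =>
      some { c with pc := c.pc + 1, creg := Function.update c.creg d (c.cmem (c.ireg a)) }
  | .cstore a b =>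
      some { c with pc := c.pc + 1, cmem := Function.update c.cmem (c.ireg a) (c.creg b) }
  | .jlt a b l => some { c with pc := if c.ireg a < c.ireg b then l else c.pc + 1 }
  | .jump l => some { c with pc := l }

/-- Execution of exactly `t` instructions of `P`; `none` if the machine crashes or runs past the
end of the program before that. -/
noncomputable def run (P : Program) : ℕ → Config → Option Config
  | 0, c => some c
  | t + 1, c => P[c.pc]?.bind fun I => (I.exec c).bind (run P t)

/-- Started in `c`, the program halts (by leaving the program text) after exactly `t` executed
instructions, with `v` in scalar register `0`. -/
def HaltsWith (P : Program) (c : Config) (t : ℕ) (v : ℂ) : Prop :=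
  ∃ c', run P t c = some c' ∧ P.length ≤ c'.pc ∧ c'.creg 0 = v

/-- The input `(n, w, s, A)`: `n` and `w` are in index registers `0` and `1`, the entries of `s` are
in cells `0, …, n - 1` of the index memory, and `A` is in row-major order in cells
`0, …, n * n - 1` of the scalar memory. Everything else is `0`. -/
def inputConfig (n w : ℕ) (s : Fin n → ℕ) (A : Matrix (Fin n) (Fin n) ℂ) : Config where
  pc := 0
  ireg := fun a => if a = 0 then n else if a = 1 then w else 0
  imem := fun a => if h : a < n then s ⟨a, h⟩ else 0
  creg := fun _ => 0
  cmem := fun a => if h : a < n * n then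
    A (Fin.divNat (⟨a, h⟩ : Fin (n * n))) (Fin.modNat (⟨a, h⟩ : Fin (n * n))) else 0

end LoopHaf

/-! The proof is a dynamic programme over a sliding window of `w + 1` indices. Expanding a loop
hafnian along a copy `v` of the smallest remaining index `i` (`lhafOn_eq_sum`) matches `v` with
itself, with another copy of `i`, or with a copy of some `i + e`, `1 ≤ e ≤ w`; the band condition
kills every other partner. Copies of one index are interchangeable, so a remaining vertex set
matters only through how many copies of each index it has. As long as the smallest index is always
expanded, indices below `i` are exhausted and indices above `i + w` are untouched, so the `w + 1`
counts in the window describe the state. With `b = c + 1` they are the base-`b` digits of a number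
`x < b ^ (w + 1)`, and removing one copy subtracts a power of `b`.

Table `i` holds these values (`IsCell`). If digit `0` of `x` is zero, the cell is copied from table
`i + 1` (`isCell_shift`); otherwise it is a combination of smaller cells of table `i`
(`isCell_step`). Table `n` starts the recursion with the empty matching, and the answer is the cell
of table `0` with digits `s_0, …, s_w` (`isCell_zero_iff`).

The machine neither multiplies nor divides natural numbers. Digits are split off by repeated
subtraction, and each subtraction adds the corresponding term once, so a cell costs `O(1 + w(c +
1))`. The total `O(n (c + 1)^(w + 1) (1 + w(c + 1)))` lies below the claimed bound with one
logarithmic factor (`pow_mul_le`). Correctness and time are proved together for a small structured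
language compiled to jumps (`Runs`). -/

namespace LoopHaf

/-! ### Loop hafnians of principal submatrices and row expansion. -/

section Subsets

variable {V : Type*} [Fintype V] [DecidableEq V]

/-- The perfect matchings, with loops allowed, of the vertices in `S`. -/
def matchingsOn (S : Finset V) : Finset (Finset (Sym2 V)) :=
  Finset.univ.filter fun π =>
    ∀ v : V, (π.filter fun e => v ∈ e).card = if v ∈ S then 1 else 0

/-- The loop hafnian of the principal submatrix of `A` on `S`. -/
def lhafOn (A : Matrix V V ℂ) (hA : A.IsSymm) (S : Finset V) : ℂ :=
  ∑ π ∈ matchingsOn S, ∏ e ∈ π, edgeWeight A hA e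

theorem mem_matchingsOn {S : Finset V} {π : Finset (Sym2 V)} :
    π ∈ matchingsOn S ↔
      ∀ v : V, (π.filter fun e => v ∈ e).card = if v ∈ S then 1 else 0 := by
  simp [matchingsOn]

theorem lhafOn_univ (A : Matrix V V ℂ) (hA : A.IsSymm) :
    lhafOn A hA Finset.univ = lhaf A hA := by
  simp [lhafOn, lhaf, matchingsOn, perfectMatchings]

theorem lhafOn_empty (A : Matrix V V ℂ) (hA : A.IsSymm) : lhafOn A hA ∅ = 1 := by
  have h : matchingsOn (∅ : Finset V) = {∅} := by
    ext π
    rw [mem_matchingsOn, Finset.mem_singleton]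
    constructor
    · intro h
      rw [Finset.eq_empty_iff_forall_notMem]
      intro e he
      induction e with
      | _ a b =>
        have := h a
        rw [if_neg (Finset.notMem_empty a), Finset.card_eq_zero] at this
        exact Finset.eq_empty_iff_forall_notMem.1 this s(a, b) (by simp [he])
    · rintro rfl
      simp
  simp [lhafOn, h]

theorem notMem_of_mem_matchingsOn {S : Finset V} {π : Finset (Sym2 V)} (hπ : π ∈ matchingsOn S)
    {v : V} (hv : v ∉ S) {e : Sym2 V} (he : v ∈ e) : e ∉ π := by
  intro h
  have := mem_matchingsOn.1 hπ v
  rw [if_neg hv, Finset.card_eq_zero] at this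
  exact Finset.eq_empty_iff_forall_notMem.1 this e (by simp [h, he])

theorem insert_mem_matchingsOn_iff {S : Finset V} {v u : V} (hv : v ∈ S) (hu : u ∈ S)
    {π : Finset (Sym2 V)} (h : s(v, u) ∉ π) :
    insert s(v, u) π ∈ matchingsOn S ↔ π ∈ matchingsOn ((S.erase v).erase u) := by
  rw [mem_matchingsOn, mem_matchingsOn]
  refine forall_congr' fun x => ?_
  rw [Finset.filter_insert]
  by_cases hx : x ∈ s(v, u)
  · have h' : s(v, u) ∉ π.filter fun e => x ∈ e := by simp [h]
    have hxS : x ∈ S := by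
      rcases Sym2.mem_iff.1 hx with rfl | rfl <;> assumption
    have hx' : x ∉ (S.erase v).erase u := by
      rcases Sym2.mem_iff.1 hx with rfl | rfl <;> simp
    rw [if_pos hx, Finset.card_insert_of_notMem h', if_pos hxS, if_neg hx']
    simp
  · rw [if_neg hx]
    have : x ∈ (S.erase v).erase u ↔ x ∈ S := by
      rw [Sym2.mem_iff, not_or] at hx
      simp [hx.1, hx.2]
    simp only [this]

/-- Expansion of the loop hafnian along the row of `v`. -/
theorem lhafOn_eq_sum (A : Matrix V V ℂ) (hA : A.IsSymm) {S : Finset V} {v : V} (hv : v ∈ S) :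
    lhafOn A hA S = ∑ u ∈ S, A v u * lhafOn A hA ((S.erase v).erase u) := by
  have hnot : ∀ u : V, ∀ π ∈ matchingsOn ((S.erase v).erase u), ∀ u', s(v, u') ∉ π :=
    fun u π hπ u' => notMem_of_mem_matchingsOn hπ (v := v) (by simp) (by simp)
  simp only [lhafOn, Finset.mul_sum]
  rw [Finset.sum_sigma']
  symm
  -- The loop at `v` is the term `u = v`; erasing `v` twice is erasing it once, so it needs no
  -- separate case.
  refine Finset.sum_bij (fun p _ => insert s(v, p.1) p.2) ?_ ?_ ?_ ?_
  · rintro ⟨u, π⟩ h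
    rw [Finset.mem_sigma] at h
    exact (insert_mem_matchingsOn_iff hv h.1 (hnot u π h.2 u)).2 h.2
  · rintro ⟨u, π⟩ h ⟨u', π'⟩ h' heq
    rw [Finset.mem_sigma] at h h'
    dsimp only at h h' heq
    have h1 : s(v, u) ∈ insert s(v, u') π' := heq ▸ Finset.mem_insert_self _ _
    have h2 : s(v, u) = s(v, u') :=
      (Finset.mem_insert.1 h1).resolve_right (hnot u' π' h'.2 u)
    have h3 : u = u' := Sym2.congr_right.1 h2
    subst h3
    have h4 : π = π' := by
      rw [← Finset.erase_insert (hnot u π h.2 u), heq, Finset.erase_insert (hnot u π' h'.2 u)]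
    rw [h4]
  · intro π hπ
    have h1 := mem_matchingsOn.1 hπ v
    rw [if_pos hv, Finset.card_eq_one] at h1
    obtain ⟨e, he⟩ := h1
    have h2 : e ∈ π.filter fun e => v ∈ e := by simp [he]
    obtain ⟨h3, u, rfl⟩ := Finset.mem_filter.1 h2
    have hu : u ∈ S := by
      by_contra hu
      exact notMem_of_mem_matchingsOn hπ hu (by simp) h3
    have h5 : insert s(v, u) (π.erase s(v, u)) = π := Finset.insert_erase h3
    refine ⟨⟨u, π.erase s(v, u)⟩, ?_, h5⟩
    rw [Finset.mem_sigma]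
    refine ⟨hu, ?_⟩
    rw [← insert_mem_matchingsOn_iff hv hu (Finset.notMem_erase _ _), h5]
    exact hπ
  · rintro ⟨u, π⟩ h
    rw [Finset.mem_sigma] at h
    dsimp only at h ⊢
    rw [Finset.prod_insert (hnot u π h.2 u)]
    rfl

end Subsets

/-! ### Base-`b` digits as a code for vectors of counts. -/

section Digits

variable {b : ℕ}

theorem pow_le_of_digit_ne_zero {x e : ℕ} (h : x / b ^ e % b ≠ 0) : b ^ e ≤ x := by
  by_contra hlt
  rw [Nat.div_eq_of_lt (not_le.1 hlt)] at h
  simp at h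

/-- Subtracting `b ^ e` lowers a nonzero digit `e` in base `b` and changes no other digit. -/
theorem digit_sub_pow (hb : 0 < b) {x e : ℕ} (h : x / b ^ e % b ≠ 0) (f : ℕ) :
    (x - b ^ e) / b ^ f % b = x / b ^ f % b - if f = e then 1 else 0 := by
  have hle := pow_le_of_digit_ne_zero h
  -- Below `e` the digits survive because `b ^ e` is a multiple of `b ^ (f + 1)`; from `e` on,
  -- because a nonzero digit `e` means that nothing is borrowed.
  rcases lt_or_ge f e with hfe | hfe
  · obtain ⟨k, rfl⟩ := Nat.exists_eq_add_of_lt hfe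
    have h1 : x - b ^ (f + k + 1) = x - b ^ f * (b * b ^ k) := by ring_nf
    have h2 : b * b ^ k ≤ x / b ^ f := by
      rw [Nat.le_div_iff_mul_le (pow_pos hb f)]
      calc b * b ^ k * b ^ f = b ^ (f + k + 1) := by ring
        _ ≤ x := hle
    rw [h1, Nat.sub_mul_div, if_neg hfe.ne, Nat.sub_mul_mod h2, Nat.sub_zero]
  · obtain ⟨k, rfl⟩ := Nat.exists_eq_add_of_le hfe
    have h1 : (x - b ^ e) / b ^ e = x / b ^ e - 1 := by
      simpa using Nat.sub_mul_div x (b ^ e) 1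
    rw [pow_add, ← Nat.div_div_eq_div_mul, ← Nat.div_div_eq_div_mul, h1]
    generalize x / b ^ e = z at h
    cases k with
    | zero =>
      simp only [pow_zero, Nat.div_one, Nat.add_zero, if_true]
      have h2 := Nat.div_add_mod z b
      have h3 := Nat.mod_lt z hb
      have h4 : z - 1 = b * (z / b) + (z % b - 1) := by omega
      rw [h4, Nat.mul_add_mod, Nat.mod_eq_of_lt (by omega)]
    | succ k =>
      have h2 := Nat.div_add_mod z b
      have h3 := Nat.mod_lt z hb
      have h4 : z - 1 = b * (z / b) + (z % b - 1) := by omega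
      have h5 : (z - 1) / b = z / b := by
        rw [h4, Nat.mul_add_div hb, Nat.div_eq_of_lt (by omega : z % b - 1 < b), Nat.add_zero]
      rw [pow_succ', ← Nat.div_div_eq_div_mul, ← Nat.div_div_eq_div_mul, h5]
      simp

theorem sum_digits_lt {d : ℕ → ℕ} (hd : ∀ e, d e < b) (k : ℕ) :
    ∑ e ∈ Finset.range k, d e * b ^ e < b ^ k := by
  induction k with
  | zero => simp
  | succ k ih =>
    rw [Finset.sum_range_succ, pow_succ']
    have : (d k + 1) * b ^ k ≤ b * b ^ k := Nat.mul_le_mul_right _ (hd k)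
    linarith

theorem digit_add_mul_pow {x k e : ℕ} (hb : 0 < b) (m : ℕ) (he : e < k) :
    (x + b ^ k * m) / b ^ e % b = x / b ^ e % b := by
  obtain ⟨j, rfl⟩ := Nat.exists_eq_add_of_lt he
  have : b ^ (e + j + 1) * m = b ^ e * (b * (b ^ j * m)) := by ring
  rw [this, Nat.add_mul_div_left _ _ (pow_pos hb e), Nat.add_mul_mod_self_left]

theorem digit_sum_digits {d : ℕ → ℕ} (hd : ∀ e, d e < b) {k e : ℕ} (he : e < k) :
    (∑ j ∈ Finset.range k, d j * b ^ j) / b ^ e % b = d e := by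
  have hb : 0 < b := (Nat.zero_le _).trans_lt (hd 0)
  induction k with
  | zero => omega
  | succ k ih =>
    rw [Finset.sum_range_succ, mul_comm (d k)]
    rcases Nat.lt_succ_iff_lt_or_eq.1 he with h | rfl
    · rw [digit_add_mul_pow hb _ h, ih h]
    · rw [Nat.add_mul_div_left _ _ (pow_pos hb e), Nat.div_eq_of_lt (sum_digits_lt hd e),
        Nat.zero_add, Nat.mod_eq_of_lt (hd e)]

end Digits

/-! ### The table cells and their recurrence. -/

section Tables

variable {n : ℕ} {s : Fin n → ℕ}

/-- The number of copies of the index `v` in `S`. -/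
def copies (S : Finset (Σ i : Fin n, Fin (s i))) (v : ℕ) : ℕ :=
  (S.filter fun x => (x.1 : ℕ) = v).card

theorem copies_erase {S : Finset (Σ i : Fin n, Fin (s i))} {x : Σ i : Fin n, Fin (s i)}
    (hx : x ∈ S) (v : ℕ) :
    copies (S.erase x) v = copies S v - if v = x.1 then 1 else 0 := by
  unfold copies
  rw [Finset.filter_erase]
  split_ifs with h
  · rw [Finset.card_erase_of_mem (by simp [hx, h])]
  · rw [Finset.erase_eq_of_notMem (by simp [Ne.symm h]), Nat.sub_zero]

theorem copies_pos {S : Finset (Σ i : Fin n, Fin (s i))} {x : Σ i : Fin n, Fin (s i)}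
    (hx : x ∈ S) : copies S x.1 ≠ 0 :=
  Finset.card_ne_zero_of_mem (a := x) (by simp [hx])

theorem copies_eq_zero_of_le (S : Finset (Σ i : Fin n, Fin (s i))) {v : ℕ} (hv : n ≤ v) :
    copies S v = 0 := by
  rw [copies, Finset.card_eq_zero, Finset.filter_eq_empty_iff]
  intro x _
  have := x.1.2
  omega

/-- `s`, continued by `0`. -/
def extend (s : Fin n → ℕ) (v : ℕ) : ℕ := if h : v < n then s ⟨v, h⟩ else 0

theorem copies_univ (v : ℕ) :
    copies (Finset.univ : Finset (Σ i : Fin n, Fin (s i))) v = extend s v := by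
  unfold extend
  split_ifs with h
  · rw [copies, ← Finset.card_fin (s ⟨v, h⟩)]
    symm
    refine Finset.card_bij (fun l _ => ⟨⟨v, h⟩, l⟩) ?_ ?_ ?_
    · simp
    · intro a _ a' _ h
      simpa using h
    · rintro ⟨⟨v', hv⟩, l⟩ hx
      simp only [Finset.mem_filter, Finset.mem_univ, true_and] at hx
      subst hx
      exact ⟨l, Finset.mem_univ _, rfl⟩
  · exact copies_eq_zero_of_le _ (not_lt.1 h)

/-- `z` is the loop hafnian of every principal submatrix of `repeated A s` with no copies of the
indices below `i`, with all copies of the indices above `i + w`, and with as many copies of the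
index `i + e` as the digit `e` of `x` in base `b` says, for `e ≤ w`. -/
def IsCell (A : Matrix (Fin n) (Fin n) ℂ) (hA : A.IsSymm) (s : Fin n → ℕ) (w b i x : ℕ)
    (z : ℂ) : Prop :=
  ∀ S : Finset (Σ i : Fin n, Fin (s i)), (∀ v < i, copies S v = 0) →
    (∀ e ≤ w, copies S (i + e) = x / b ^ e % b) → (∀ v, i + w < v → copies S v = extend s v) →
    lhafOn (repeated A s) (repeated_isSymm hA s) S = z

variable {A : Matrix (Fin n) (Fin n) ℂ} {hA : A.IsSymm} {w b : ℕ}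

/-- Every vertex has index below `n`, so only the empty set qualifies, and the empty matching has
weight `1`. -/
theorem isCell_last : IsCell A hA s w b n 0 1 := by
  intro S h _ _
  have : S = ∅ := by
    rw [Finset.eq_empty_iff_forall_notMem]
    exact fun x hx => copies_pos hx (h _ x.1.2)
  rw [this, lhafOn_empty]

/-- Digit `0` of `b * y` is zero: index `i` is used up and the window can move on. All digits slide
down by one, and the index `i + w + 1` enters at the top with all its copies. -/
theorem isCell_shift (hs : ∀ v, extend s v < b) {i y : ℕ} (hy : y < b ^ w) {z : ℂ}
    (h : IsCell A hA s w b (i + 1) (y + b ^ w * extend s (i + w + 1)) z) :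
    IsCell A hA s w b i (b * y) z := by
  have hb : 0 < b := (Nat.zero_le _).trans_lt (hs 0)
  intro S h1 h2 h3
  refine h S ?_ ?_ ?_
  · intro v hv
    rcases Nat.lt_succ_iff_lt_or_eq.1 hv with hv | rfl
    · exact h1 v hv
    · simpa using h2 0 (Nat.zero_le _)
  · intro e he
    rcases he.lt_or_eq with he | rfl
    · rw [digit_add_mul_pow hb _ he, add_assoc, add_comm 1 e, h2 (e + 1) he, pow_succ',
        Nat.mul_div_mul_left _ _ hb]
    · rw [h3 _ (by omega), Nat.add_mul_div_left _ _ (pow_pos hb e), Nat.div_eq_of_lt hy,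
        Nat.zero_add, Nat.mod_eq_of_lt (hs _)]
      congr 1
      omega
  · intro v hv
    exact h3 v (by omega)

theorem isCell_zero_iff (hs : ∀ v, extend s v < b) {z : ℂ}
    (h : IsCell A hA s w b 0 (∑ e ∈ Finset.range (w + 1), extend s e * b ^ e) z) :
    lhaf (repeated A s) (repeated_isSymm hA s) = z := by
  rw [← lhafOn_univ]
  refine h _ (by simp) ?_ ?_
  · intro e he
    rw [copies_univ, digit_sum_digits hs (Nat.lt_succ_of_le he), Nat.zero_add]
  · intro v _
    exact copies_univ v

/-- Reduces the expansion over individual vertices to one term per offset in the window, weighted by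
multiplicity. By `h` the subtraction `u.1 - i` never truncates. -/
theorem sum_copies {S : Finset (Σ i : Fin n, Fin (s i))} {i : ℕ} (h : ∀ v < i, copies S v = 0)
    (γ : ℕ → ℂ) (hγ : ∀ e, w < e → γ e = 0) :
    ∑ u ∈ S, γ (u.1 - i) = ∑ e ∈ Finset.range (w + 1), (copies S (i + e) : ℂ) * γ e := by
  have hi : ∀ u ∈ S, i ≤ u.1 := by
    intro u hu
    by_contra hlt
    exact copies_pos hu (h _ (not_le.1 hlt))
  have hsub : ∑ u ∈ S.filter (fun u => (u.1 : ℕ) - i ∈ Finset.range (w + 1)), γ (u.1 - i) =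
      ∑ u ∈ S, γ (u.1 - i) := by
    refine Finset.sum_filter_of_ne fun u _ hne => ?_
    by_contra hlt
    rw [Finset.mem_range] at hlt
    exact hne (hγ _ (by omega))
  rw [← hsub, ← Finset.sum_fiberwise_of_maps_to
    (t := Finset.range (w + 1)) (g := fun u => (u.1 : ℕ) - i) (by simp)]
  refine Finset.sum_congr rfl fun e he => ?_
  rw [Finset.sum_congr rfl (g := fun _ => γ e)
    (by intro u hu; rw [(Finset.mem_filter.1 hu).2]), Finset.sum_const, nsmul_eq_mul]
  congr 2
  rw [copies]
  congr 1
  ext u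
  simp only [Finset.mem_filter]
  constructor
  · rintro ⟨⟨h1, _⟩, h2⟩
    have := hi u h1
    exact ⟨h1, by omega⟩
  · rintro ⟨h1, h2⟩
    have := Finset.mem_range.1 he
    exact ⟨⟨h1, Finset.mem_range.2 (by omega)⟩, by omega⟩

/-- The recurrence for the cells: a copy of `i` is matched with itself, with one of the `r` other
copies of `i`, or with a copy of some `i + e + 1`. -/
theorem isCell_step (hband : IsBanded A w) (hb : 0 < b) {i : ℕ} (hi : i < n) {y r : ℕ}
    (hr : r + 1 < b) (f α g : ℕ → ℂ)
    (hf : ∀ x < b * y + (r + 1), IsCell A hA s w b i x (f x))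
    (hα : ∀ e < w, ∀ h : i + e + 1 < n, α e = A ⟨i, hi⟩ ⟨i + e + 1, h⟩)
    (hg : ∀ e < w, b ^ (e + 1) ≤ b * y + r → g e = f (b * y + r - b ^ (e + 1))) {z z' : ℂ}
    (hz : z = f (b * y + r)) (hz' : r ≠ 0 → z' = f (b * y + r - 1)) :
    IsCell A hA s w b i (b * y + (r + 1))
      (A ⟨i, hi⟩ ⟨i, hi⟩ * (z + r * z') +
        ∑ e ∈ Finset.range w, ((y / b ^ e % b : ℕ) : ℂ) * (α e * g e)) := by
  set x := b * y + (r + 1) with hx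
  have hx0 : x / b ^ 0 % b = r + 1 := by
    rw [pow_zero, Nat.div_one, hx, Nat.mul_add_mod, Nat.mod_eq_of_lt hr]
  have hxne : x / b ^ 0 % b ≠ 0 := by omega
  have hdig : ∀ e, x / b ^ (e + 1) % b = y / b ^ e % b := by
    intro e
    rw [pow_succ', ← Nat.div_div_eq_div_mul, hx, Nat.mul_add_div hb, Nat.div_eq_of_lt hr,
      Nat.add_zero]
  have hd1 : ∀ e, (x - 1) / b ^ e % b = x / b ^ e % b - if e = 0 then 1 else 0 := by
    intro e
    simpa using digit_sub_pow hb hxne e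
  intro S h1 h2 h3
  have hc0 : copies S i = r + 1 := by rw [← hx0, ← h2 0 (Nat.zero_le _), Nat.add_zero]
  obtain ⟨v, hv⟩ : (S.filter fun x => (x.1 : ℕ) = i).Nonempty := by
    rw [← Finset.card_ne_zero]
    change copies S i ≠ 0
    omega
  obtain ⟨hv, hvi⟩ := Finset.mem_filter.1 hv
  have hvi' : v.1 = ⟨i, hi⟩ := Fin.ext hvi
  have hA' : ∀ u, repeated A s v u = A ⟨i, hi⟩ u.1 := by
    intro u
    rw [← hvi']
    rfl
  have hce : ∀ u, copies (S.erase v) u = copies S u - if u = i then 1 else 0 := by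
    intro u
    rw [copies_erase hv, hvi]
  have hlow : ∀ u < i, copies (S.erase v) u = 0 := by
    intro u hu
    rw [hce, h1 u hu, Nat.zero_sub]
  rw [lhafOn_eq_sum _ _ hv, ← Finset.add_sum_erase _ _ hv, Finset.erase_idem]
  have hfirst : lhafOn (repeated A s) (repeated_isSymm hA s) (S.erase v) = f (x - 1) := by
    refine hf (x - 1) (by omega) _ hlow ?_ ?_
    · intro e he
      rw [hce, h2 e he, hd1]
      simp
    · intro u hu
      rw [hce, h3 u hu, if_neg (by omega), Nat.sub_zero]
  -- The contribution of a partner other than `v` itself, as a function of its offset alone.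
  set γ : ℕ → ℂ := fun e => if e = 0 then A ⟨i, hi⟩ ⟨i, hi⟩ * z' else
    if e ≤ w then α (e - 1) * g (e - 1) else 0 with hγ
  have hrest : ∀ u ∈ S.erase v, repeated A s v u *
      lhafOn (repeated A s) (repeated_isSymm hA s) ((S.erase v).erase u) = γ (u.1 - i) := by
    intro u hu
    have hiu : i ≤ u.1 := by
      by_contra hlt
      exact copies_pos hu (hlow _ (not_le.1 hlt))
    obtain ⟨e, he⟩ := Nat.exists_eq_add_of_le hiu
    rw [hA', he, Nat.add_sub_cancel_left]
    rcases le_or_gt e w with hew | hew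
    · have hpos := copies_pos hu
      -- The partner `u` is itself a remaining copy, so its digit is nonzero and removing it
      -- subtracts `b ^ e` without a borrow.
      have hdne : (x - 1) / b ^ e % b ≠ 0 := by
        rw [he, hce, h2 e hew] at hpos
        rw [hd1]
        simpa using hpos
      have hcell : lhafOn (repeated A s) (repeated_isSymm hA s) ((S.erase v).erase u) =
          f (x - 1 - b ^ e) := by
        refine hf _ (by omega) _ ?_ ?_ ?_
        · intro t ht
          rw [copies_erase hu, hlow t ht, Nat.zero_sub]
        · intro e' he'
          rw [copies_erase hu, hce, h2 e' he', digit_sub_pow hb hdne, hd1, he]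
          simp
        · intro t ht
          rw [copies_erase hu, hce, h3 t ht, if_neg (by omega), if_neg (by omega)]
          simp
      rw [hcell]
      cases e with
      | zero =>
        have hu' : u.1 = ⟨i, hi⟩ := Fin.ext (by simpa using he)
        have hr0 : r ≠ 0 := by
          rw [hd1, hx0] at hdne
          simpa using hdne
        rw [hu']
        simp only [hγ, if_true]
        rw [hz' hr0]
        congr 2
      | succ e =>
        have hlt : i + e + 1 < n := by
          have := u.1.2
          omega
        have hu' : u.1 = ⟨i + e + 1, hlt⟩ := Fin.ext (by simpa [add_assoc] using he)
        simp only [hγ, Nat.succ_ne_zero, if_false, if_pos hew, Nat.add_sub_cancel]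
        rw [hα e hew hlt, hu', hg e hew]
        · rfl
        · exact pow_le_of_digit_ne_zero hdne
    · have : A ⟨i, hi⟩ u.1 = 0 := by
        refine hband _ _ ?_
        rw [he, abs_sub_comm]
        push_cast
        rw [add_sub_cancel_left, abs_of_nonneg (by positivity)]
        exact_mod_cast hew
      rw [this, zero_mul]
      simp only [hγ]
      rw [if_neg (by omega), if_neg (by omega)]
  rw [Finset.sum_congr rfl hrest, sum_copies (w := w) hlow γ, Finset.sum_range_succ', hfirst, hA',
    hvi', Nat.add_zero, hce, hc0, if_pos rfl, Nat.add_sub_cancel, hz]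
  · have hsum : ∀ e ∈ Finset.range w, (copies (S.erase v) (i + (e + 1)) : ℂ) * γ (e + 1) =
        ((y / b ^ e % b : ℕ) : ℂ) * (α e * g e) := by
      intro e he
      have he := Finset.mem_range.1 he
      rw [hce, if_neg (by omega), Nat.sub_zero, h2 _ he, hdig]
      simp only [hγ, Nat.succ_ne_zero, if_false, Nat.add_sub_cancel]
      rw [if_pos (by omega)]
    rw [Finset.sum_congr rfl hsum]
    simp only [hγ, if_true]
    rw [show x - 1 = b * y + r by omega]
    ring
  · intro e he
    simp only [hγ]
    rw [if_neg (by omega), if_neg (by omega)]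

end Tables

/-! ### Structured programs -/

/-- A configuration without its line number. -/
structure Mem where
  ireg : ℕ → ℕ
  imem : ℕ → ℕ
  creg : ℕ → ℂ
  cmem : ℕ → ℂ

/-- The configuration with memory `σ` at line `l`. -/
def Mem.at (σ : Mem) (l : ℕ) : Config := ⟨l, σ.ireg, σ.imem, σ.creg, σ.cmem⟩

/-- Instructions that neither crash nor jump. -/
def Instr.plain : Instr → Bool
  | .cdiv _ _ _ | .jlt _ _ _ | .jump _ => false
  | _ => true

/-- The effect of a plain instruction on the memory. -/
def Instr.effect (σ : Mem) : Instr → Mem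
  | .iconst d k => { σ with ireg := Function.update σ.ireg d k }
  | .iadd d a b => { σ with ireg := Function.update σ.ireg d (σ.ireg a + σ.ireg b) }
  | .isub d a b => { σ with ireg := Function.update σ.ireg d (σ.ireg a - σ.ireg b) }
  | .iload d a => { σ with ireg := Function.update σ.ireg d (σ.imem (σ.ireg a)) }
  | .istore a b => { σ with imem := Function.update σ.imem (σ.ireg a) (σ.ireg b) }
  | .cconst d k => { σ with creg := Function.update σ.creg d (k : ℂ) }
  | .cadd d a b => { σ with creg := Function.update σ.creg d (σ.creg a + σ.creg b) }
  | .csub d a b => { σ with creg := Function.update σ.creg d (σ.creg a - σ.creg b) }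
  | .cmul d a b => { σ with creg := Function.update σ.creg d (σ.creg a * σ.creg b) }
  | .cload d a => { σ with creg := Function.update σ.creg d (σ.cmem (σ.ireg a)) }
  | .cstore a b => { σ with cmem := Function.update σ.cmem (σ.ireg a) (σ.creg b) }
  | .cdiv _ _ _ | .jlt _ _ _ | .jump _ => σ

theorem Instr.exec_at {I : Instr} (hI : I.plain = true) (σ : Mem) (l : ℕ) :
    I.exec (σ.at l) = some ((I.effect σ).at (l + 1)) := by
  cases I <;> first | rfl | simp [Instr.plain] at hI

/-- Structured programs: blocks of plain instructions, composition, and loops that run as long as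
index register `a` holds less than index register `b`. -/
inductive Stmt where
  | ops (L : List Instr)
  | seq (S T : Stmt)
  | loop (a b : ℕ) (S : Stmt)

namespace Stmt

/-- The number of lines of the compiled program. -/
def size : Stmt → ℕ
  | ops L => L.length
  | seq S T => S.size + T.size
  | loop _ _ S => S.size + 3

/-- The program text, if its first line has number `l`. -/
def compile : Stmt → ℕ → Program
  | ops L, _ => L
  | seq S T, l => S.compile l ++ T.compile (l + S.size)
  | loop a b S, l => [.jlt a b (l + 2), .jump (l + S.size + 3)] ++ S.compile (l + 2) ++ [.jump l]

theorem length_compile (S : Stmt) (l : ℕ) : (S.compile l).length = S.size := by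
  induction S generalizing l with
  | ops L => rfl
  | seq S T hS hT => simp [compile, size, hS, hT]
  | loop a b S hS => simp [compile, size, hS]

end Stmt

theorem run_add (P : Program) (t u : ℕ) (c : Config) :
    run P (t + u) c = (run P t c).bind (run P u) := by
  induction t generalizing c with
  | zero => simp [run]
  | succ t ih =>
    rw [Nat.add_right_comm]
    simp only [run, Option.bind_assoc, ih]

theorem run_succ_of_exec {P : Program} {c c' : Config} {I : Instr} (hI : P[c.pc]? = some I)
    (h : I.exec c = some c') (t : ℕ) : run P (t + 1) c = run P t c' := by
  simp [run, hI, h]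

/-- `S`, started with memory `σ`, takes at most `T` steps and ends with a memory satisfying `Q`. -/
def Runs (S : Stmt) (σ : Mem) (T : ℕ) (Q : Mem → Prop) : Prop :=
  ∀ (l : ℕ) (L R : Program), L.length = l →
    ∃ t ≤ T, ∃ σ', run (L ++ S.compile l ++ R) t (σ.at l) = some (σ'.at (l + S.size)) ∧ Q σ'

theorem Runs.mono {S : Stmt} {σ : Mem} {T T' : ℕ} {Q Q' : Mem → Prop} (h : Runs S σ T Q)
    (hT : T ≤ T') (hQ : ∀ σ', Q σ' → Q' σ') : Runs S σ T' Q' := by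
  intro l L R hl
  obtain ⟨t, ht, σ', h1, h2⟩ := h l L R hl
  exact ⟨t, ht.trans hT, σ', h1, hQ _ h2⟩

theorem Runs.ops {L : List Instr} {σ : Mem} {Q : Mem → Prop} (hL : L.all Instr.plain = true)
    (h : Q (L.foldl Instr.effect σ)) : Runs (.ops L) σ L.length Q := by
  intro l K R hl
  refine ⟨L.length, le_rfl, _, ?_, h⟩
  clear h
  simp only [Stmt.compile, Stmt.size]
  induction L generalizing K σ l with
  | nil => simp [run]
  | cons I L ih =>
    rw [List.all_cons, Bool.and_eq_true] at hL
    have hI : (K ++ I :: L ++ R)[(σ.at l).pc]? = some I := by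
      simp [Mem.at, ← hl]
    rw [List.length_cons, run_succ_of_exec hI (Instr.exec_at hL.1 σ l)]
    have := ih (σ := I.effect σ) hL.2 (l + 1) (K ++ [I]) (by simp [hl])
    simpa [add_assoc, add_comm 1] using this

/-- Jump targets are absolute, so each part must run correctly inside any surrounding text: the
second part belongs to the right context of the first, and the first to the left context of the
second. -/
theorem Runs.seq {S S' : Stmt} {σ : Mem} {T T' : ℕ} {Q : Mem → Prop}
    (h : Runs S σ T fun σ' => Runs S' σ' T' Q) : Runs (.seq S S') σ (T + T') Q := by
  intro l L R hl
  obtain ⟨t, ht, σ', h1, h2⟩ := h l L (S'.compile (l + S.size) ++ R) hl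
  obtain ⟨u, hu, σ'', h3, h4⟩ := h2 (l + S.size) (L ++ S.compile l) R
    (by simp [hl, Stmt.length_compile])
  refine ⟨t + u, add_le_add ht hu, σ'', ?_, h4⟩
  have e1 : L ++ (Stmt.seq S S').compile l ++ R =
      L ++ S.compile l ++ (S'.compile (l + S.size) ++ R) := by
    simp [Stmt.compile]
  have e2 : L ++ S.compile l ++ (S'.compile (l + S.size) ++ R) =
      L ++ S.compile l ++ S'.compile (l + S.size) ++ R := by
    simp
  rw [e1, run_add, h1, Option.bind_some, e2, h3, Stmt.size, add_assoc]

/-- The loop rule: `Inv k` holds when `k` rounds are left, and a round takes at most `T` steps. -/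
theorem Runs.loop {a b : ℕ} {S : Stmt} {T : ℕ} (Inv : ℕ → Mem → Prop)
    (h0 : ∀ σ, Inv 0 σ → σ.ireg b ≤ σ.ireg a)
    (hs : ∀ k σ, Inv (k + 1) σ → σ.ireg a < σ.ireg b ∧ Runs S σ T (Inv k))
    {k : ℕ} {σ : Mem} (h : Inv k σ) : Runs (.loop a b S) σ (k * (T + 2) + 2) (Inv 0) := by
  intro l L R hl
  have g0 : (L ++ (Stmt.loop a b S).compile l ++ R)[l]? = some (.jlt a b (l + 2)) := by
    simp [Stmt.compile, ← hl]
  have g1 : (L ++ (Stmt.loop a b S).compile l ++ R)[l + 1]? = some (.jump (l + S.size + 3)) := by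
    simp [Stmt.compile, ← hl]
  have g2 : (L ++ (Stmt.loop a b S).compile l ++ R)[l + 2 + S.size]? = some (.jump l) := by
    have e : L ++ (Stmt.loop a b S).compile l ++ R =
      (L ++ [.jlt a b (l + 2), .jump (l + S.size + 3)] ++ S.compile (l + 2)) ++
        (.jump l :: R) := by simp [Stmt.compile]
    have hlen : (L ++ [Instr.jlt a b (l + 2), Instr.jump (l + S.size + 3)] ++
        S.compile (l + 2)).length = l + 2 + S.size := by simp [Stmt.length_compile, hl]; omega
    rw [e, List.getElem?_append_right hlen.le, hlen]
    simp
  induction k generalizing σ with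
  | zero =>
    -- Leaving the loop costs two steps: the failed comparison and the jump past the body.
    refine ⟨2, by omega, σ, ?_, h⟩
    rw [run_succ_of_exec (c := σ.at l) g0 (c' := σ.at (l + 1)), run_succ_of_exec g1 rfl]
    · simp [run, Mem.at, Stmt.size, add_assoc]
    · simp [Instr.exec, Mem.at, not_lt.2 (h0 σ h)]
  | succ k ih =>
    obtain ⟨hlt, hS⟩ := hs k σ h
    obtain ⟨t, ht, σ', h1, h2⟩ := hS (l + 2) (L ++ [.jlt a b (l + 2), .jump (l + S.size + 3)])
      (.jump l :: R) (by simp [hl])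
    obtain ⟨u, hu, σ'', h3, h4⟩ := ih h2
    refine ⟨t + (u + 1) + 1, ?_, σ'', ?_, h4⟩
    · rw [Nat.add_one_mul]
      omega
    · rw [run_succ_of_exec (c := σ.at l) g0 (c' := σ.at (l + 2)), run_add]
      · have e : L ++ (Stmt.loop a b S).compile l ++ R =
          L ++ [.jlt a b (l + 2), .jump (l + S.size + 3)] ++ S.compile (l + 2) ++
            (.jump l :: R) := by simp [Stmt.compile]
        rw [← e] at h1
        rw [h1, Option.bind_some, run_succ_of_exec (c := σ'.at (l + 2 + S.size)) g2 rfl]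
        exact h3
      · simp [Instr.exec, Mem.at, hlt]

theorem Runs.haltsWith {S : Stmt} {σ : Mem} {T : ℕ} {v : ℂ}
    (h : Runs S σ T fun σ' => σ'.creg 0 = v) :
    ∃ t ≤ T, HaltsWith (S.compile 0) (σ.at 0) t v := by
  obtain ⟨t, ht, σ', h1, h2⟩ := h 0 [] [] rfl
  refine ⟨t, ht, σ'.at (0 + S.size), by simpa using h1, ?_, h2⟩
  simp [Mem.at, Stmt.length_compile]

/-! ### The program

Index registers: `0` holds `n`, `1` holds `w`, `2` holds `0`, `3` holds `1`, `4` holds `c`,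
`5` holds `b = c + 1`, `9` the address of the table of the powers of `b`, `10` holds `b ^ w`,
`11` holds `b ^ (w + 1)`, `12` the address of the current table, `13` the address of `A i i`,
`14` holds `i`, `15` the address of a cell of the preceding table, `16` the number formed by the
upper digits of the current cell, `17` the address of the current cell; the others are temporary.
Scalar register `5` holds `1`, and `4` the number of copies of `i` other than the expanded one. -/

/-- Index register `d` is increased by `a` times `k`, and `k` is cleared. -/
def mulAdd (a k d : ℕ) : Stmt := .loop 2 k (.ops [.iadd d d a, .isub k k 3])

/-- Adds scalar register `3` to scalar register `1` as often as index register `21` can be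
subtracted from index register `19` with a positive result. -/
def unitLoop : Stmt := .loop 21 19 (.ops [.isub 19 19 21, .cadd 1 1 3])

def digitPre : Stmt := .ops
  [.iadd 7 9 20, .iload 22 7, .isub 20 20 3, .isub 7 7 3, .iload 21 7, .iadd 7 13 20, .iadd 7 7 3,
    .cload 2 7, .isub 7 17 3, .isub 7 7 22, .cload 3 7, .cmul 3 2 3]

def digitLoop : Stmt := .loop 2 20 (.seq digitPre unitLoop)

def cellPre : Stmt := .ops
  [.isub 7 17 3, .cload 2 13, .cload 1 7, .isub 7 7 3, .cload 3 7, .cmul 3 4 3, .cadd 1 1 3,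
    .cmul 1 2 1, .iadd 19 16 3, .iadd 20 1 2]

def cellPost : Stmt := .ops [.cstore 17 1, .iadd 17 17 3, .cadd 4 4 5, .isub 18 18 3]

def cellLoop : Stmt := .loop 2 18 (.seq cellPre (.seq digitLoop cellPost))

def rowPre : Stmt := .ops
  [.cload 1 15, .cstore 17 1, .iadd 15 15 3, .iadd 17 17 3, .iadd 18 4 2, .cconst 4 0]

def rowLoop : Stmt := .loop 16 10 (.seq rowPre (.seq cellLoop (.ops [.iadd 16 16 3])))

def tablePre : Stmt := .ops
  [.isub 14 14 3, .isub 13 13 0, .isub 13 13 3, .iadd 7 14 1, .iadd 7 7 3, .iload 8 7,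
    .iadd 15 12 2]

def tableLoop : Stmt := .loop 2 14 (.seq tablePre (.seq (mulAdd 10 8 15)
  (.seq (.ops [.iadd 12 12 11, .iadd 17 12 2, .iconst 16 0]) rowLoop)))

def maxLoop : Stmt := .loop 6 0 (.ops [.iload 7 6, .isub 7 7 4, .iadd 4 4 7, .iadd 6 6 3])

def powPre : Stmt := .ops
  [.iadd 5 4 3, .iadd 9 0 1, .iadd 9 9 3, .istore 9 3, .iadd 10 3 2, .iconst 6 0]

def powLoop : Stmt := .loop 6 1 (.seq (.ops [.iconst 11 0, .iadd 8 5 2]) (.seq (mulAdd 10 8 11)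
  (.ops [.iadd 10 11 2, .iadd 6 6 3, .iadd 7 9 6, .istore 7 10])))

def addressLoop : Stmt := .loop 6 16 (.seq (.ops [.iadd 7 9 6, .iload 10 7, .iload 8 6])
  (.seq (mulAdd 10 8 15) (.ops [.iadd 6 6 3])))

def setup : Stmt :=
  .seq (.ops [.iconst 3 1, .cconst 5 1]) <| .seq maxLoop <| .seq powPre <| .seq powLoop <|
  .seq (.ops [.iconst 11 0, .iadd 8 5 2]) <| .seq (mulAdd 10 8 11) <|
  .seq (.ops [.iconst 12 0, .iadd 8 0 2]) <| .seq (mulAdd 0 8 12) <|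
  .ops [.cstore 12 5, .iadd 13 12 0, .iadd 14 0 2]

def readOff : Stmt :=
  .seq (.ops [.iadd 15 12 2, .iconst 6 0, .iadd 16 1 3]) <| .seq addressLoop <| .ops [.cload 0 15]

def lhafProgram : Stmt := .seq setup (.seq tableLoop readOff)

/-! ### Correctness and cost of the arithmetic loops. -/

theorem runs_mulAdd {a k d : ℕ} {σ : Mem} (h2 : σ.ireg 2 = 0) (h3 : σ.ireg 3 = 1)
    (hak : a ≠ k) (had : a ≠ d) (hkd : k ≠ d) (hk2 : k ≠ 2) (hk3 : k ≠ 3) (hd2 : d ≠ 2)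
    (hd3 : d ≠ 3) {Q : Mem → Prop}
    (hQ : Q { σ with
      ireg := Function.update (Function.update σ.ireg d (σ.ireg d + σ.ireg a * σ.ireg k)) k 0 }) :
    Runs (mulAdd a k d) σ (σ.ireg k * 4 + 2) Q := by
  refine (Runs.loop (fun m σ' => m ≤ σ.ireg k ∧ σ' = { σ with
    ireg := Function.update (Function.update σ.ireg d
      (σ.ireg d + σ.ireg a * (σ.ireg k - m))) k m }) (T := 2) ?_ ?_ ?_).mono le_rfl ?_
  · rintro _ ⟨_, rfl⟩
    simp
  · rintro m _ ⟨hm, rfl⟩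
    refine ⟨?_, Runs.ops rfl ⟨by omega, ?_⟩⟩
    · simp [hk2.symm, hd2.symm, h2]
    · simp only [List.foldl, Instr.effect, Mem.mk.injEq, and_true]
      funext r
      have e : σ.ireg k - m = σ.ireg k - (m + 1) + 1 := by omega
      by_cases hr : r = k
      · simp [hr, hkd, hk3.symm, hd3.symm, h3]
      · by_cases hr' : r = d
        · subst hr'
          simp [hr, hak, had, e, mul_add, add_assoc]
        · simp [hr, hr']
  · refine ⟨le_rfl, ?_⟩
    rw [Nat.sub_self, Nat.mul_zero, Nat.add_zero, Function.update_eq_self,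
      Function.update_eq_self]
  · rintro _ ⟨_, rfl⟩
    simpa using hQ

/-- Division with remainder by `p`, with the quotient used as a scalar factor on the way. Register
`19` holds the dividend plus one, so that the strict comparison of the loop decides whether `p`
still fits. -/
theorem runs_unitLoop {σ : Mem} {q p z : ℕ} (hz : z < p) (h19 : σ.ireg 19 = p * q + z + 1)
    (h21 : σ.ireg 21 = p) {Q : Mem → Prop}
    (hQ : Q { σ with
      ireg := Function.update σ.ireg 19 (z + 1)
      creg := Function.update σ.creg 1 (σ.creg 1 + q * σ.creg 3) }) :
    Runs unitLoop σ (q * 4 + 2) Q := by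
  refine (Runs.loop (fun m σ' => m ≤ q ∧ σ' = { σ with
    ireg := Function.update σ.ireg 19 (p * m + z + 1)
    creg := Function.update σ.creg 1 (σ.creg 1 + (q - m : ℕ) * σ.creg 3) }) (T := 2)
    ?_ ?_ ?_).mono le_rfl ?_
  · rintro _ ⟨_, rfl⟩
    simp [h21]
    omega
  · rintro m _ ⟨hm, rfl⟩
    refine ⟨?_, Runs.ops rfl ⟨by omega, ?_⟩⟩
    · simp [h21, mul_add]
      omega
    · have e : q - m = q - (m + 1) + 1 := by omega
      simp only [List.foldl, Instr.effect, Mem.mk.injEq, true_and, and_true]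
      constructor
      · funext r
        by_cases hr : r = 19
        · subst hr
          simp [h21, mul_add]
          omega
        · simp [hr]
      · funext r
        by_cases hr : r = 1
        · subst hr
          rw [e]
          simp
          ring
        · simp [hr]
  · refine ⟨le_rfl, ?_⟩
    rw [Nat.sub_self, ← h19]
    simp
  · rintro _ ⟨_, rfl⟩
    simpa using hQ

/-- What does not change after the setup. -/
structure Ready {n : ℕ} (w c : ℕ) (s : Fin n → ℕ) (σ : Mem) : Prop where
  r0 : σ.ireg 0 = n
  r1 : σ.ireg 1 = w
  r2 : σ.ireg 2 = 0
  r3 : σ.ireg 3 = 1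
  r4 : σ.ireg 4 = c
  r9 : σ.ireg 9 = n + w + 1
  r10 : σ.ireg 10 = (c + 1) ^ w
  r11 : σ.ireg 11 = (c + 1) ^ (w + 1)
  c5 : σ.creg 5 = 1
  pow : ∀ e ≤ w, σ.imem (n + w + 1 + e) = (c + 1) ^ e
  input : ∀ v ≤ n + w, σ.imem v = extend s v

/-- `σ'` has the same index memory as `σ`, and the same contents in the index registers outside `R`
and in the scalar registers outside `C`. -/
structure Agree (R C : List ℕ) (σ σ' : Mem) : Prop where
  ireg : ∀ r ∉ R, σ'.ireg r = σ.ireg r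
  creg : ∀ r ∉ C, σ'.creg r = σ.creg r
  imem : σ'.imem = σ.imem

theorem Agree.refl (R C : List ℕ) (σ : Mem) : Agree R C σ σ := ⟨fun _ _ => rfl, fun _ _ => rfl, rfl⟩

theorem Agree.trans {R C R' C' : List ℕ} {σ σ' σ'' : Mem} (h : Agree R C σ σ')
    (h' : Agree R' C' σ' σ'') (hR : R' ⊆ R := by decide) (hC : C' ⊆ C := by decide) :
    Agree R C σ σ'' :=
  ⟨fun r hr => (h'.ireg r fun h => hr (hR h)).trans (h.ireg r hr),
    fun r hr => (h'.creg r fun h => hr (hC h)).trans (h.creg r hr), h'.imem.trans h.imem⟩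

theorem Ready.of_agree {n w c : ℕ} {s : Fin n → ℕ} {R C : List ℕ} {σ σ' : Mem}
    (h : Ready w c s σ) (h' : Agree R C σ σ')
    (hR : ∀ r ∈ [0, 1, 2, 3, 4, 9, 10, 11], r ∉ R := by decide) (hC : 5 ∉ C := by decide) :
    Ready w c s σ' where
  r0 := (h'.ireg 0 (hR 0 (by decide))).trans h.r0
  r1 := (h'.ireg 1 (hR 1 (by decide))).trans h.r1
  r2 := (h'.ireg 2 (hR 2 (by decide))).trans h.r2
  r3 := (h'.ireg 3 (hR 3 (by decide))).trans h.r3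
  r4 := (h'.ireg 4 (hR 4 (by decide))).trans h.r4
  r9 := (h'.ireg 9 (hR 9 (by decide))).trans h.r9
  r10 := (h'.ireg 10 (hR 10 (by decide))).trans h.r10
  r11 := (h'.ireg 11 (hR 11 (by decide))).trans h.r11
  c5 := (h'.creg 5 hC).trans h.c5
  pow := by rw [h'.imem]; exact h.pow
  input := by rw [h'.imem]; exact h.input

section Loops

variable {n w c : ℕ} {s : Fin n → ℕ} {σ : Mem}

/-- The part of the recurrence with partners of index above `i`. Where a digit is zero, the loaded
address may be meaningless, but the product formed from it is then added zero times. -/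
theorem runs_digitLoop (hσ : Ready w c s σ) {y : ℕ} (hy : y < (c + 1) ^ w)
    (h19 : σ.ireg 19 = y + 1) (h20 : σ.ireg 20 = w) {Q : Mem → Prop}
    (hQ : ∀ σ', Agree [7, 19, 20, 21, 22] [1, 2, 3] σ σ' → σ'.cmem = σ.cmem →
      σ'.creg 1 = σ.creg 1 + ∑ e ∈ Finset.range w, ((y / (c + 1) ^ e % (c + 1) : ℕ) : ℂ) *
        (σ.cmem (σ.ireg 13 + e + 1) * σ.cmem (σ.ireg 17 - 1 - (c + 1) ^ (e + 1))) → Q σ') :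
    Runs digitLoop σ (w * (4 * c + 16) + 2) Q := by
  set f : ℕ → ℂ := fun e => ((y / (c + 1) ^ e % (c + 1) : ℕ) : ℂ) *
    (σ.cmem (σ.ireg 13 + e + 1) * σ.cmem (σ.ireg 17 - 1 - (c + 1) ^ (e + 1))) with hf
  -- Digits are split off from the top: with `m` rounds left, `y % (c + 1) ^ m` is still to be
  -- decomposed and the terms `e < m` are still to be added.
  refine (Runs.loop (fun m σ' => m ≤ w ∧ Agree [7, 19, 20, 21, 22] [1, 2, 3] σ σ' ∧
    σ'.cmem = σ.cmem ∧ σ'.ireg 20 = m ∧ σ'.ireg 19 = y % (c + 1) ^ m + 1 ∧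
    σ'.creg 1 + ∑ e ∈ Finset.range m, f e = σ.creg 1 + ∑ e ∈ Finset.range w, f e)
    (T := 12 + (c * 4 + 2)) ?_ ?_ (k := w) ?_).mono ?_ ?_
  · rintro σ' ⟨_, hA, _, h, _⟩
    rw [h]
    exact Nat.zero_le _
  · rintro m σ' ⟨hm, hA, hc, h20, h19, hsum⟩
    have hσ' := hσ.of_agree hA
    refine ⟨by rw [h20, hσ'.r2]; omega, Runs.seq (Runs.ops rfl ?_)⟩
    have hdig : y % (c + 1) ^ (m + 1) / (c + 1) ^ m = y / (c + 1) ^ m % (c + 1) := by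
      rw [pow_succ, Nat.mod_mul_right_div_self]
    have hmod : y % (c + 1) ^ (m + 1) % (c + 1) ^ m = y % (c + 1) ^ m :=
      Nat.mod_mod_of_dvd _ (pow_dvd_pow _ (Nat.le_succ m))
    have hlt : y / (c + 1) ^ m % (c + 1) ≤ c := Nat.lt_succ_iff.1 (Nat.mod_lt _ (Nat.succ_pos c))
    have h13 := hA.ireg 13 (by decide)
    have h17 := hA.ireg 17 (by decide)
    have hp1 := hσ'.pow (m + 1) hm
    have hp0 := hσ'.pow m (by omega)
    have ha1 : n + w + 1 + (m + 1) - 1 = n + w + 1 + m := by omega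
    refine (runs_unitLoop (q := y / (c + 1) ^ m % (c + 1)) (p := (c + 1) ^ m)
      (z := y % (c + 1) ^ m) (Nat.mod_lt _ (by positivity)) ?_ ?_
      (Q := fun σ'' => m ≤ w ∧ Agree [7, 19, 20, 21, 22] [1, 2, 3] σ σ'' ∧
    σ''.cmem = σ.cmem ∧ σ''.ireg 20 = m ∧ σ''.ireg 19 = y % (c + 1) ^ m + 1 ∧
    σ''.creg 1 + ∑ e ∈ Finset.range m, f e = σ.creg 1 + ∑ e ∈ Finset.range w, f e)
      ?_).mono (by omega) fun _ h => h
    · simp [Instr.effect, h19]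
      rw [← hdig, ← hmod, Nat.div_add_mod]
    · simp [Instr.effect, hσ'.r9, h20, hσ'.r3, ha1, hp0]
    · refine ⟨by omega, ⟨?_, ?_, hA.imem⟩, hc, ?_, ?_, ?_⟩
      · intro r hr
        rw [← hA.ireg r hr]
        simp only [List.mem_cons, List.not_mem_nil, or_false, not_or] at hr
        simp [Instr.effect, hr]
      · intro r hr
        rw [← hA.creg r hr]
        simp only [List.mem_cons, List.not_mem_nil, or_false, not_or] at hr
        simp [Instr.effect, hr]
      · simp [Instr.effect, h20, hσ'.r3]
      · simp
      · rw [← hsum, Finset.sum_range_succ]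
        simp [Instr.effect, h20, hσ'.r3, hσ'.r9, hp1, h13, h17, hc, hf]
        ring
  · exact ⟨le_rfl, Agree.refl _ _ _, rfl, h20, by rw [h19, Nat.mod_eq_of_lt hy], rfl⟩
  · ring_nf; omega
  · rintro σ' ⟨_, hA, hc, _, _, hsum⟩
    exact hQ σ' hA hc (by simpa using hsum)

end Loops

/-! ### Filling a block, a table, and all tables. -/

section TableLoops

variable {n w c : ℕ} {s : Fin n → ℕ} {σ : Mem} {A : Matrix (Fin n) (Fin n) ℂ} {hA : A.IsSymm}

theorem entry_lt (i j : Fin n) : n * i + j < n * n :=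
  calc n * i + j < n * i + n := Nat.add_lt_add_left j.2 _
    _ = n * (i + 1) := rfl
    _ ≤ n * n := Nat.mul_le_mul_left n i.2

/-- Cells are filled in increasing order, and the recurrence refers only to smaller cells of the
same table, which starts at address `q`. -/
theorem runs_cellLoop (hσ : Ready w c s σ) (hband : IsBanded A w) {i y q : ℕ} (hi : i < n)
    (hy : y < (c + 1) ^ w) (hq : n * n ≤ q) (h13 : σ.ireg 13 = (n + 1) * i) (h16 : σ.ireg 16 = y)
    (h17 : σ.ireg 17 = q + ((c + 1) * y + 1)) (h18 : σ.ireg 18 = c) (h4 : σ.creg 4 = 0)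
    (hent : ∀ i j : Fin n, σ.cmem (n * i + j) = A i j)
    (hcell : ∀ x < (c + 1) * y + 1, IsCell A hA s w (c + 1) i x (σ.cmem (q + x)))
    {Q : Mem → Prop}
    (hQ : ∀ σ', Agree [7, 17, 18, 19, 20, 21, 22] [1, 2, 3, 4] σ σ' →
      σ'.ireg 17 = q + (c + 1) * (y + 1) → (∀ a < q, σ'.cmem a = σ.cmem a) →
      (∀ x < (c + 1) * (y + 1), IsCell A hA s w (c + 1) i x (σ'.cmem (q + x))) → Q σ') :
    Runs cellLoop σ (c * (w * (4 * c + 16) + 18) + 2) Q := by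
  refine (Runs.loop (fun m σ' => ∃ r, r + m = c ∧
    Agree [7, 17, 18, 19, 20, 21, 22] [1, 2, 3, 4] σ σ' ∧ σ'.ireg 18 = m ∧
    σ'.ireg 17 = q + ((c + 1) * y + (r + 1)) ∧ σ'.creg 4 = r ∧ (∀ a < q, σ'.cmem a = σ.cmem a) ∧
    ∀ x < (c + 1) * y + (r + 1), IsCell A hA s w (c + 1) i x (σ'.cmem (q + x)))
    (T := 10 + (w * (4 * c + 16) + 2 + 4)) ?_ ?_ (k := c) ?_).mono ?_ ?_
  · rintro σ' ⟨r, _, _, h, _⟩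
    rw [h]
    exact Nat.zero_le _
  · rintro m σ' ⟨r, hr, hAg, h18, h17, h4, hlow, hcell⟩
    have hσ' := hσ.of_agree hAg
    refine ⟨by rw [h18, hσ'.r2]; omega, Runs.seq (Runs.ops rfl ?_)⟩
    simp only [List.foldl]
    have h13 := (hAg.ireg 13 (by decide)).trans h13
    have h16 := (hAg.ireg 16 (by decide)).trans h16
    have hx1 : q + ((c + 1) * y + (r + 1)) - 1 = q + ((c + 1) * y + r) := by omega
    -- The memory after the block is named, the facts needed later are extracted, and its value is
    -- then forgotten to keep the terms small.
    set σ₂ : Mem := _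
    change Runs _ σ₂ _ _
    have hAg2 : Agree [7, 19, 20] [1, 2, 3] σ' σ₂ := by
      refine ⟨?_, ?_, rfl⟩
      · intro r hr
        simp only [List.mem_cons, List.not_mem_nil, or_false, not_or] at hr
        simp [σ₂, Instr.effect, hr]
      · intro r hr
        simp only [List.mem_cons, List.not_mem_nil, or_false, not_or] at hr
        simp [σ₂, Instr.effect, hr]
    have hc2 : σ₂.cmem = σ'.cmem := rfl
    have hv : σ₂.creg 1 = σ'.cmem ((n + 1) * i) * (σ'.cmem (q + ((c + 1) * y + r)) +
        r * σ'.cmem (q + ((c + 1) * y + r) - 1)) := by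
      simp [σ₂, Instr.effect, h13, h17, h4, hσ'.r3, hx1]
    have h19 : σ₂.ireg 19 = y + 1 := by simp [σ₂, Instr.effect, h16, hσ'.r3]
    have h20 : σ₂.ireg 20 = w := by simp [σ₂, Instr.effect, hσ'.r1, hσ'.r2]
    clear_value σ₂
    refine Runs.seq (runs_digitLoop (hσ'.of_agree hAg2) hy h19 h20 ?_)
    intro σ₃ hAg3 hc3 hv3
    rw [hv, hAg2.ireg 13 (by decide), hAg2.ireg 17 (by decide), hc2, h13, h17, hx1] at hv3
    have hAg4 := (hAg.trans hAg2).trans hAg3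
    have hσ3 := hσ.of_agree hAg4
    have h17' : σ₃.ireg 17 = q + ((c + 1) * y + (r + 1)) := by
      rw [hAg3.ireg 17 (by decide), hAg2.ireg 17 (by decide), h17]
    have h18' : σ₃.ireg 18 = m + 1 := by
      rw [hAg3.ireg 18 (by decide), hAg2.ireg 18 (by decide), h18]
    have h4' : σ₃.creg 4 = r := by
      rw [hAg3.creg 4 (by decide), hAg2.creg 4 (by decide), h4]
    have hc3' : σ₃.cmem = σ'.cmem := hc3.trans hc2
    have hent' : ∀ i j : Fin n, σ'.cmem (n * i + j) = A i j := fun i j =>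
      (hlow _ ((entry_lt i j).trans_le hq)).trans (hent i j)
    refine Runs.ops rfl ⟨r + 1, by omega, ⟨?_, ?_, hAg4.imem⟩, ?_, ?_, ?_, ?_, ?_⟩
    · intro r hr
      rw [← hAg4.ireg r hr]
      simp only [List.mem_cons, List.not_mem_nil, or_false, not_or] at hr
      simp [Instr.effect, hr]
    · intro r hr
      rw [← hAg4.creg r hr]
      simp only [List.mem_cons, List.not_mem_nil, or_false, not_or] at hr
      simp [Instr.effect, hr]
    · simp [Instr.effect, h18', hσ3.r3]
    · simp [Instr.effect, h17', hσ3.r3]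
      omega
    · simp [Instr.effect, h4', hσ3.c5]
    · intro a ha
      rw [← hlow a ha]
      have : a ≠ q + ((c + 1) * y + (r + 1)) := by omega
      simp [Instr.effect, h17', this, hc3']
    · intro x hx
      rcases Nat.lt_succ_iff_lt_or_eq.1 hx with hx | rfl
      · have : x ≠ (c + 1) * y + (r + 1) := hx.ne
        simpa [Instr.effect, h17', this, hc3'] using hcell x hx
      -- The functions passed here read whatever is stored at the computed addresses; `isCell_step`
      -- constrains them only where the address is meaningful.
      · have := isCell_step hband (Nat.succ_pos c) hi (y := y) (r := r) (by omega)
          (fun x => σ'.cmem (q + x)) (fun e => σ'.cmem ((n + 1) * i + e + 1))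
          (fun e => σ'.cmem (q + ((c + 1) * y + r) - (c + 1) ^ (e + 1))) hcell ?_ ?_
          (z := σ'.cmem (q + ((c + 1) * y + r))) (z' := σ'.cmem (q + ((c + 1) * y + r) - 1)) rfl ?_
        · have hAii : σ'.cmem ((n + 1) * i) = A ⟨i, hi⟩ ⟨i, hi⟩ := by
            rw [← hent' ⟨i, hi⟩ ⟨i, hi⟩, Nat.add_one_mul]
          rw [← hAii, ← hv3] at this
          simpa [Instr.effect, h17'] using this
        · intro e _ h
          rw [← hent' ⟨i, hi⟩ ⟨i + e + 1, h⟩]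
          congr 1
          ring
        · intro e _ h
          rw [Nat.add_sub_assoc h]
        · intro hr0
          rw [Nat.add_sub_assoc (by omega)]
  · exact ⟨0, by omega, Agree.refl _ _ _, h18, h17, by simpa using h4, fun _ _ => rfl, hcell⟩
  · ring_nf; omega
  · rintro σ' ⟨r, hr, hAg, _, h17, _, hlow, hcell⟩
    have e : (c + 1) * (y + 1) = (c + 1) * y + (r + 1) := by rw [mul_add, mul_one, ← hr, Nat.add_zero]
    exact hQ σ' hAg (by rw [h17, e]) hlow (by rw [e]; exact hcell)

/-- A bound for the time that `rowLoop` takes. -/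
def rowTime (w c : ℕ) : ℕ := (c + 1) ^ w * (c * (w * (4 * c + 16) + 18) + 11) + 2

/-- Each block of `c + 1` cells opens with a copy from the preceding table, which ends just below
`q`. `h15` says that register `15` points to the copied cell for `y = 0`; consecutive blocks copy
consecutive cells. -/
theorem runs_rowLoop (hσ : Ready w c s σ) (hband : IsBanded A w) (hs : ∀ v, extend s v < c + 1)
    {i q : ℕ} (hi : i < n) (hq : n * n ≤ q) (h13 : σ.ireg 13 = (n + 1) * i)
    (h15 : σ.ireg 15 + (c + 1) ^ (w + 1) = q + (c + 1) ^ w * extend s (i + w + 1))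
    (h16 : σ.ireg 16 = 0) (h17 : σ.ireg 17 = q)
    (hent : ∀ i j : Fin n, σ.cmem (n * i + j) = A i j)
    (hprev : ∀ x < (c + 1) ^ (w + 1),
      IsCell A hA s w (c + 1) (i + 1) x (σ.cmem (q + x - (c + 1) ^ (w + 1))))
    {Q : Mem → Prop}
    (hQ : ∀ σ', Agree [7, 15, 16, 17, 18, 19, 20, 21, 22] [1, 2, 3, 4] σ σ' →
      (∀ a < q, σ'.cmem a = σ.cmem a) →
      (∀ x < (c + 1) ^ (w + 1), IsCell A hA s w (c + 1) i x (σ'.cmem (q + x))) → Q σ') :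
    Runs rowLoop σ (rowTime w c) Q := by
  refine (Runs.loop (fun m σ' => ∃ y, y + m = (c + 1) ^ w ∧
    Agree [7, 15, 16, 17, 18, 19, 20, 21, 22] [1, 2, 3, 4] σ σ' ∧ σ'.ireg 15 = σ.ireg 15 + y ∧
    σ'.ireg 16 = y ∧ σ'.ireg 17 = q + (c + 1) * y ∧ (∀ a < q, σ'.cmem a = σ.cmem a) ∧
    ∀ x < (c + 1) * y, IsCell A hA s w (c + 1) i x (σ'.cmem (q + x)))
    (T := 6 + (c * (w * (4 * c + 16) + 18) + 2 + 1)) ?_ ?_ (k := (c + 1) ^ w) ?_).mono ?_ ?_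
  · rintro σ' ⟨y, hy, hAg, _, h16, _⟩
    rw [h16, (hσ.of_agree hAg).r10, ← hy]
    simp
  · rintro m σ' ⟨y, hy, hAg, h15', h16, h17, hlow, hcell⟩
    have hσ' := hσ.of_agree hAg
    have hyw : y < (c + 1) ^ w := by omega
    refine ⟨by rw [h16, hσ'.r10]; exact hyw, Runs.seq (Runs.ops rfl ?_)⟩
    simp only [List.foldl]
    have h13 := (hAg.ireg 13 (by decide)).trans h13
    have hent' : ∀ i j : Fin n, σ'.cmem (n * i + j) = A i j := fun i j =>
      (hlow _ ((entry_lt i j).trans_le hq)).trans (hent i j)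
    set σ₂ : Mem := _
    change Runs _ σ₂ _ _
    have hAg2 : Agree [15, 17, 18] [1, 4] σ' σ₂ := by
      refine ⟨?_, ?_, rfl⟩
      · intro r hr
        simp only [List.mem_cons, List.not_mem_nil, or_false, not_or] at hr
        simp [σ₂, Instr.effect, hr]
      · intro r hr
        simp only [List.mem_cons, List.not_mem_nil, or_false, not_or] at hr
        simp [σ₂, Instr.effect, hr]
    have hc2 : σ₂.cmem = Function.update σ'.cmem (q + (c + 1) * y) (σ'.cmem (σ'.ireg 15)) := by
      simp [σ₂, Instr.effect, h17]
    have e15 : σ₂.ireg 15 = σ.ireg 15 + (y + 1) := by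
      simp [σ₂, Instr.effect, h15', hσ'.r3, add_assoc]
    have e17 : σ₂.ireg 17 = q + ((c + 1) * y + 1) := by
      simp [σ₂, Instr.effect, h17, hσ'.r3, add_assoc]
    have e18 : σ₂.ireg 18 = c := by simp [σ₂, Instr.effect, hσ'.r4, hσ'.r2]
    have e4 : σ₂.creg 4 = 0 := by simp [σ₂, Instr.effect]
    clear_value σ₂
    have hlow2 : ∀ a < q, σ₂.cmem a = σ'.cmem a := by
      intro a ha
      have : a ≠ q + (c + 1) * y := by omega
      simp [hc2, this]
    refine Runs.seq (runs_cellLoop (A := A) (hA := hA) (hσ'.of_agree hAg2) hband hi hyw hq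
      (by rw [hAg2.ireg 13 (by decide), h13])
      (by rw [hAg2.ireg 16 (by decide), h16]) e17 e18 e4
      (fun i j => (hlow2 _ ((entry_lt i j).trans_le hq)).trans (hent' i j)) ?_ ?_)
    · intro x hx
      rcases Nat.lt_succ_iff_lt_or_eq.1 hx with hx | rfl
      · simpa [hc2, hx.ne] using hcell x hx
      · rw [hc2, Function.update_self, h15']
        refine isCell_shift hs hyw ?_
        have hb : y + (c + 1) ^ w * extend s (i + w + 1) < (c + 1) ^ (w + 1) :=
          calc y + (c + 1) ^ w * extend s (i + w + 1)
              < (c + 1) ^ w + (c + 1) ^ w * extend s (i + w + 1) := Nat.add_lt_add_right hyw _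
            _ = (c + 1) ^ w * (extend s (i + w + 1) + 1) := by ring
            _ ≤ (c + 1) ^ w * (c + 1) := Nat.mul_le_mul_left _ (hs _)
        have hlt : σ.ireg 15 + y < q := by omega
        rw [hlow _ hlt]
        have := hprev _ hb
        rwa [show q + (y + (c + 1) ^ w * extend s (i + w + 1)) - (c + 1) ^ (w + 1) =
          σ.ireg 15 + y by omega] at this
    · intro σ₃ hAg3 h17' hlow3 hcell3
      have hAg4 := (hAg.trans hAg2).trans hAg3
      have hσ3 := hσ.of_agree hAg4
      have e15' : σ₃.ireg 15 = σ.ireg 15 + (y + 1) := by rw [hAg3.ireg 15 (by decide), e15]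
      have e16' : σ₃.ireg 16 = y := by
        rw [hAg3.ireg 16 (by decide), hAg2.ireg 16 (by decide), h16]
      refine Runs.ops rfl ⟨y + 1, by omega, ⟨?_, hAg4.creg, hAg4.imem⟩, ?_, ?_, ?_, ?_, ?_⟩
      · intro r hr
        rw [← hAg4.ireg r hr]
        simp only [List.mem_cons, List.not_mem_nil, or_false, not_or] at hr
        simp [Instr.effect, hr]
      · simpa [Instr.effect] using e15'
      · simp [Instr.effect, e16', hσ3.r3]
      · simpa [Instr.effect] using h17'
      · intro a ha
        exact (hlow3 a ha).trans ((hlow2 a ha).trans (hlow a ha))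
      · exact hcell3
  · exact ⟨0, by omega, Agree.refl _ _ _, rfl, h16, by simpa using h17, fun _ _ => rfl, by simp⟩
  · rw [rowTime]
    ring_nf; omega
  · rintro σ' ⟨y, hy, hAg, _, _, _, hlow, hcell⟩
    rw [Nat.add_zero] at hy
    rw [hy, ← pow_succ'] at hcell
    exact hQ σ' hAg hlow hcell

/-- While the index falls from `n` to `0`, the tables are stacked upwards behind the matrix, so
neither `A` nor the preceding table is overwritten. -/
theorem runs_tableLoop (hσ : Ready w c s σ) (hband : IsBanded A w) (hs : ∀ v, extend s v < c + 1)
    (h12 : σ.ireg 12 = n * n) (h13 : σ.ireg 13 = (n + 1) * n) (h14 : σ.ireg 14 = n)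
    (hent : ∀ i j : Fin n, σ.cmem (n * i + j) = A i j)
    (hprev : ∀ x < (c + 1) ^ (w + 1), IsCell A hA s w (c + 1) n x (σ.cmem (n * n + x)))
    {Q : Mem → Prop}
    (hQ : ∀ σ', Ready w c s σ' →
      (∀ x < (c + 1) ^ (w + 1), IsCell A hA s w (c + 1) 0 x (σ'.cmem (σ'.ireg 12 + x))) → Q σ') :
    Runs tableLoop σ (n * (4 * c + 14 + rowTime w c) + 2) Q := by
  refine (Runs.loop (fun m σ' => m ≤ n ∧ Agree [7, 8, 12, 13, 14, 15, 16, 17, 18, 19, 20, 21, 22]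
    [1, 2, 3, 4] σ σ' ∧ n * n ≤ σ'.ireg 12 ∧ σ'.ireg 13 = (n + 1) * m ∧ σ'.ireg 14 = m ∧
    (∀ i j : Fin n, σ'.cmem (n * i + j) = A i j) ∧
    ∀ x < (c + 1) ^ (w + 1), IsCell A hA s w (c + 1) m x (σ'.cmem (σ'.ireg 12 + x)))
    (T := 7 + (c * 4 + 2 + (3 + rowTime w c))) ?_ ?_ (k := n) ?_).mono ?_ ?_
  · rintro σ' ⟨_, _, _, _, h, _⟩
    rw [h]
    exact Nat.zero_le _
  · rintro m σ' ⟨hm, hAg, hq, h13, h14, hent, hprev⟩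
    have hσ' := hσ.of_agree hAg
    refine ⟨by rw [h14, hσ'.r2]; omega, Runs.seq (Runs.ops rfl ?_)⟩
    simp only [List.foldl]
    set σ₂ : Mem := _
    change Runs _ σ₂ _ _
    have hAg2 : Agree [7, 8, 13, 14, 15] [] σ' σ₂ := by
      refine ⟨?_, fun _ _ => rfl, rfl⟩
      intro r hr
      simp only [List.mem_cons, List.not_mem_nil, or_false, not_or] at hr
      simp [σ₂, Instr.effect, hr]
    have hc2 : σ₂.cmem = σ'.cmem := rfl
    have e14 : σ₂.ireg 14 = m := by simp [σ₂, Instr.effect, h14, hσ'.r3]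
    have e13 : σ₂.ireg 13 = (n + 1) * m := by
      simp [σ₂, Instr.effect, h13, hσ'.r3, hσ'.r0]
      rw [mul_add]
      omega
    have e8 : σ₂.ireg 8 = extend s (m + w + 1) := by
      -- The address may pass the end of `s`, but it is at most `n + w`, and the cells from `n` to
      -- `n + w` hold `0`.
      rw [← hσ'.input (m + w + 1) (by omega)]
      simp [σ₂, Instr.effect, h14, hσ'.r3, hσ'.r1]
    have e15 : σ₂.ireg 15 = σ'.ireg 12 := by simp [σ₂, Instr.effect, hσ'.r2]
    clear_value σ₂
    have hσ2 := hσ'.of_agree hAg2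
    refine Runs.seq ((runs_mulAdd (a := 10) (k := 8) (d := 15) hσ2.r2 hσ2.r3 (by decide)
      (by decide) (by decide) (by decide) (by decide) (by decide) (by decide) ?_).mono
      (T' := c * 4 + 2) ?_ fun _ h => h)
    swap
    · have := hs (m + w + 1)
      rw [e8]
      omega
    refine Runs.seq (Runs.ops rfl ?_)
    simp only [List.foldl]
    set σ₃ : Mem := _
    change Runs _ σ₃ _ _
    have hAg3 : Agree [8, 12, 15, 16, 17] [] σ₂ σ₃ := by
      refine ⟨?_, fun _ _ => rfl, rfl⟩
      intro r hr
      simp only [List.mem_cons, List.not_mem_nil, or_false, not_or] at hr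
      simp [σ₃, Instr.effect, hr]
    have hc3 : σ₃.cmem = σ'.cmem := hc2
    have f12 : σ₃.ireg 12 = σ'.ireg 12 + (c + 1) ^ (w + 1) := by
      simp [σ₃, Instr.effect, hσ2.r11, hAg2.ireg 12]
    have f17 : σ₃.ireg 17 = σ'.ireg 12 + (c + 1) ^ (w + 1) := by
      simp [σ₃, Instr.effect, hσ2.r11, hσ2.r2, hAg2.ireg 12]
    have f16 : σ₃.ireg 16 = 0 := by simp [σ₃, Instr.effect]
    have f15 : σ₃.ireg 15 = σ'.ireg 12 + (c + 1) ^ w * extend s (m + w + 1) := by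
      simp [σ₃, Instr.effect, e15, e8, hσ2.r10]
    clear_value σ₃
    have hAg4 := (hAg.trans hAg2).trans hAg3
    refine runs_rowLoop (A := A) (hA := hA) (hσ.of_agree hAg4) hband hs (i := m)
      (q := σ'.ireg 12 + (c + 1) ^ (w + 1)) (by omega) (by omega)
      (by rw [hAg3.ireg 13 (by decide), e13]) (by rw [f15]; ring) f16 f17
      (by rw [hc3]; exact hent) ?_ ?_
    · intro x hx
      rw [hc3, show σ'.ireg 12 + (c + 1) ^ (w + 1) + x - (c + 1) ^ (w + 1) = σ'.ireg 12 + x by omega]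
      exact hprev x hx
    · intro σ₅ hAg5 hlow hcell
      refine ⟨by omega, hAg4.trans hAg5, ?_, ?_, ?_, ?_, ?_⟩
      · rw [hAg5.ireg 12 (by decide), f12]
        omega
      · rw [hAg5.ireg 13 (by decide), hAg3.ireg 13 (by decide), e13]
      · rw [hAg5.ireg 14 (by decide), hAg3.ireg 14 (by decide), e14]
      · intro i j
        rw [hlow _ ((entry_lt i j).trans_le (by omega)), hc3, hent]
      · rw [hAg5.ireg 12 (by decide), f12]
        exact hcell
  · exact ⟨le_rfl, Agree.refl _ _ _, h12.ge, h13, h14, hent, by rw [h12]; exact hprev⟩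
  · ring_nf; omega
  · rintro σ' ⟨_, hAg, _, _, _, _, hcell⟩
    exact hQ σ' (hσ.of_agree hAg) hcell

end TableLoops

theorem eq_zero_of_digits {b x k : ℕ} (hx : x < b ^ k) (h : ∀ e < k, x / b ^ e % b = 0) :
    x = 0 := by
  induction k with
  | zero => simpa using hx
  | succ k ih =>
    refine ih ?_ fun e he => h e (he.trans k.lt_succ_self)
    have h1 := h k k.lt_succ_self
    rw [pow_succ, mul_comm] at hx
    rw [Nat.mod_eq_of_lt (Nat.div_lt_of_lt_mul (by rwa [mul_comm] at hx))] at h1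
    rcases Nat.div_eq_zero_iff.1 h1 with h2 | h2
    · rw [h2] at hx
      simp at hx
    · exact h2

/-! ### Initialisation, reading off the answer, and the whole program. -/

section Setup

variable {n w c : ℕ} {s : Fin n → ℕ} {A : Matrix (Fin n) (Fin n) ℂ} {hA : A.IsSymm}

/-- Vacuous: a nonzero digit would demand copies of an index that is at least `n`. Hence table `n`
needs no initialisation beyond cell `0`. -/
theorem isCell_last_of_ne_zero {b x : ℕ} (hx : x < b ^ (w + 1)) (h0 : x ≠ 0) (z : ℂ) :
    IsCell A hA s w b n x z := by
  intro S _ h _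
  refine absurd (eq_zero_of_digits hx fun e he => ?_) h0
  rw [← h e (Nat.lt_succ_iff.1 he), copies_eq_zero_of_le S (Nat.le_add_right n e)]

theorem sup_extend (s : Fin n → ℕ) : (Finset.range n).sup (extend s) = Finset.univ.sup s := by
  apply le_antisymm
  · refine Finset.sup_le fun v hv => ?_
    have hv := Finset.mem_range.1 hv
    rw [extend, dif_pos hv]
    exact Finset.le_sup (f := s) (Finset.mem_univ _)
  · refine Finset.sup_le fun v _ => ?_
    have h : s v = extend s v := by rw [extend, dif_pos v.2]
    rw [h]
    exact Finset.le_sup (f := extend s) (Finset.mem_range.2 v.2)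

theorem extend_lt (hc : c = Finset.univ.sup s) (v : ℕ) : extend s v < c + 1 := by
  unfold extend
  split_ifs with h
  · rw [Nat.lt_succ_iff, hc]
    exact Finset.le_sup (f := s) (Finset.mem_univ _)
  · exact Nat.succ_pos c

/-- With truncated subtraction, `a + (b - a)` is the maximum of `a` and `b`, so no branching is
needed. -/
theorem runs_maxLoop {σ : Mem} (h0 : σ.ireg 0 = n) (h3 : σ.ireg 3 = 1) (h4 : σ.ireg 4 = 0)
    (h6 : σ.ireg 6 = 0) {Q : Mem → Prop}
    (hQ : ∀ σ', Agree [4, 6, 7] [] σ σ' → σ'.cmem = σ.cmem →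
      σ'.ireg 4 = (Finset.range n).sup σ.imem → Q σ') :
    Runs maxLoop σ (n * 6 + 2) Q := by
  refine (Runs.loop (fun m σ' => ∃ k, k + m = n ∧ Agree [4, 6, 7] [] σ σ' ∧ σ'.cmem = σ.cmem ∧
    σ'.ireg 6 = k ∧ σ'.ireg 4 = (Finset.range k).sup σ.imem) (T := 4) ?_ ?_ (k := n) ?_).mono
    le_rfl ?_
  · rintro σ' ⟨k, hk, hAg, _, h6, _⟩
    rw [h6, hAg.ireg 0 (by decide), h0, ← hk]
    simp
  · rintro m σ' ⟨k, hk, hAg, hc, h6, h4⟩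
    have h3 := (hAg.ireg 3 (by decide)).trans h3
    refine ⟨by rw [h6, hAg.ireg 0 (by decide), h0]; omega,
      Runs.ops rfl ⟨k + 1, by omega, ⟨?_, hAg.creg, hAg.imem⟩, hc, ?_, ?_⟩⟩
    · intro r hr
      rw [← hAg.ireg r hr]
      simp only [List.mem_cons, List.not_mem_nil, or_false, not_or] at hr
      simp [Instr.effect, hr]
    · simp [Instr.effect, h6, h3]
    · rw [Finset.range_add_one, Finset.sup_insert]
      simp only [List.foldl, Instr.effect]
      simp [h6, hAg.imem, h4]
      omega
  · exact ⟨0, by omega, Agree.refl _ _ _, rfl, h6, by simpa using h4⟩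
  · rintro σ' ⟨k, hk, hAg, hc, _, h4⟩
    rw [Nat.add_zero] at hk
    exact hQ σ' hAg hc (by rw [h4, hk])

/-- The powers are stored from address `n + w + 1` on, which leaves the zeros that continue `s` in
place. -/
theorem runs_powLoop {σ : Mem} (h1 : σ.ireg 1 = w) (h2 : σ.ireg 2 = 0) (h3 : σ.ireg 3 = 1)
    (h5 : σ.ireg 5 = c + 1) (h6 : σ.ireg 6 = 0) (h9 : σ.ireg 9 = n + w + 1) (h10 : σ.ireg 10 = 1)
    (hinput : ∀ v ≤ n + w, σ.imem v = extend s v) (hone : σ.imem (n + w + 1) = 1)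
    {Q : Mem → Prop}
    (hQ : ∀ σ', (∀ r ∉ [6, 7, 8, 10, 11], σ'.ireg r = σ.ireg r) → σ'.creg = σ.creg →
      σ'.cmem = σ.cmem → σ'.ireg 10 = (c + 1) ^ w → (∀ v ≤ n + w, σ'.imem v = extend s v) →
      (∀ e ≤ w, σ'.imem (n + w + 1 + e) = (c + 1) ^ e) → Q σ') :
    Runs powLoop σ (w * (4 * c + 14) + 2) Q := by
  refine (Runs.loop (fun m σ' => ∃ k, k + m = w ∧
    (∀ r ∉ [6, 7, 8, 10, 11], σ'.ireg r = σ.ireg r) ∧ σ'.creg = σ.creg ∧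
    σ'.cmem = σ.cmem ∧ σ'.ireg 6 = k ∧ σ'.ireg 10 = (c + 1) ^ k ∧
    (∀ v ≤ n + w, σ'.imem v = extend s v) ∧ ∀ e ≤ k, σ'.imem (n + w + 1 + e) = (c + 1) ^ e)
    (T := 2 + ((c + 1) * 4 + 2 + 4)) ?_ ?_ (k := w) ?_).mono ?_ ?_
  · rintro σ' ⟨k, hk, hR, _, _, h6, _⟩
    rw [h6, hR 1 (by decide), h1, ← hk]
    simp
  · rintro m σ' ⟨k, hk, hR, hC, hc, h6, h10, hinput, hpow⟩
    have h1 := (hR 1 (by decide)).trans h1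
    have h2 := (hR 2 (by decide)).trans h2
    have h3 := (hR 3 (by decide)).trans h3
    have h5 := (hR 5 (by decide)).trans h5
    have h9 := (hR 9 (by decide)).trans h9
    refine ⟨by rw [h6, h1]; omega, Runs.seq (Runs.ops rfl ?_)⟩
    refine Runs.seq ((runs_mulAdd (a := 10) (k := 8) (d := 11) ?_ ?_ (by decide)
      (by decide) (by decide) (by decide) (by decide) (by decide) (by decide) ?_).mono
      (T' := (c + 1) * 4 + 2) ?_ fun _ h => h)
    · simp [Instr.effect, h2]
    · simp [Instr.effect, h3]
    · refine Runs.ops rfl ⟨k + 1, by omega, ?_, hC, hc, ?_, ?_, ?_, ?_⟩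
      · intro r hr
        rw [← hR r hr]
        simp only [List.mem_cons, List.not_mem_nil, or_false, not_or] at hr
        simp [Instr.effect, hr]
      · simp [Instr.effect, h6, h3]
      · simp [Instr.effect, h10, h5, h2, pow_succ]
      · intro v hv
        have : v ≠ n + w + 1 + (k + 1) := by omega
        simp [Instr.effect, h9, h6, h3, this, hinput v hv]
      · intro e he
        by_cases h : e = k + 1
        · subst h
          simp [Instr.effect, h9, h6, h3, h10, h5, h2, pow_succ]
        · have := hpow e (by omega)
          simpa [Instr.effect, h9, h6, h3, h] using this
    · simp [Instr.effect, h5, h2]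
  · refine ⟨0, by omega, fun _ _ => rfl, rfl, rfl, h6, by simpa using h10, hinput, ?_⟩
    intro e he
    obtain rfl := Nat.le_zero.1 he
    simpa using hone
  · ring_nf; omega
  · rintro σ' ⟨k, hk, hR, hC, hc, _, h10, hinput, hpow⟩
    rw [Nat.add_zero] at hk
    subst hk
    exact hQ σ' hR hC hc h10 hinput hpow

/-- The memory of the input configuration. -/
def inputMem (n w : ℕ) (s : Fin n → ℕ) (A : Matrix (Fin n) (Fin n) ℂ) : Mem :=
  ⟨(inputConfig n w s A).ireg, (inputConfig n w s A).imem, (inputConfig n w s A).creg,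
    (inputConfig n w s A).cmem⟩

theorem inputMem_cmem (i j : Fin n) : (inputMem n w s A).cmem (n * i + j) = A i j := by
  have h := entry_lt i j
  have hn : 0 < n := (Nat.zero_le _).trans_lt i.2
  simp only [inputMem, inputConfig, dif_pos h]
  congr 1
  · ext
    simp [Fin.divNat, Nat.mul_add_div hn, Nat.div_eq_of_lt j.2]
  · ext
    simp [Fin.modNat, Nat.mod_eq_of_lt j.2]

theorem runs_setup (hc : c = Finset.univ.sup s) {Q : Mem → Prop}
    (hQ : ∀ σ, Ready w c s σ → σ.ireg 12 = n * n → σ.ireg 13 = (n + 1) * n → σ.ireg 14 = n →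
      σ.cmem = Function.update (inputMem n w s A).cmem (n * n) 1 → Q σ) :
    Runs setup (inputMem n w s A) (10 * n + w * (4 * c + 14) + 4 * c + 29) Q := by
  have key : Runs setup (inputMem n w s A) (2 + (n * 6 + 2 + (6 + (w * (4 * c + 14) + 2 +
      (2 + ((c + 1) * 4 + 2 + (2 + (n * 4 + 2 + 3)))))))) Q := by
    refine Runs.seq (Runs.ops rfl (Runs.seq (runs_maxLoop (n := n) ?_ ?_ ?_ ?_ ?_)))
    · simp [Instr.effect, inputMem, inputConfig]
    · simp [Instr.effect]
    · simp [Instr.effect, inputMem, inputConfig]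
    · simp [Instr.effect, inputMem, inputConfig]
    intro σ₁ hAg1 hc1 h4
    have i0 : σ₁.ireg 0 = n := by
      rw [hAg1.ireg 0 (by decide)]; simp [Instr.effect, inputMem, inputConfig]
    have i1 : σ₁.ireg 1 = w := by
      rw [hAg1.ireg 1 (by decide)]; simp [Instr.effect, inputMem, inputConfig]
    have i2 : σ₁.ireg 2 = 0 := by
      rw [hAg1.ireg 2 (by decide)]; simp [Instr.effect, inputMem, inputConfig]
    have i3 : σ₁.ireg 3 = 1 := by
      rw [hAg1.ireg 3 (by decide)]; simp [Instr.effect]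
    have c5 : σ₁.creg 5 = 1 := by
      rw [hAg1.creg 5 (by decide)]; simp [Instr.effect]
    have him : ∀ v, σ₁.imem v = extend s v := by
      intro v
      rw [hAg1.imem]
      rfl
    have i4 : σ₁.ireg 4 = c := by
      rw [h4, hc, ← sup_extend]
      rfl
    replace hc1 : σ₁.cmem = (inputMem n w s A).cmem := hc1
    clear hAg1 h4 hc
    refine Runs.seq (Runs.ops rfl (Runs.seq (runs_powLoop (n := n) (w := w) (c := c) (s := s)
      ?_ ?_ ?_ ?_ ?_ ?_ ?_ ?_ ?_ ?_)))
    · simp [Instr.effect, i1]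
    · simp [Instr.effect, i2]
    · simp [Instr.effect, i3]
    · simp [Instr.effect, i3, i4]
    · simp [Instr.effect]
    · simp [Instr.effect, i0, i1, i3]
    · simp [Instr.effect, i2, i3]
    · intro v hv
      have : v ≠ n + w + 1 := by omega
      simp [Instr.effect, i0, i1, i3, him, this]
    · simp [Instr.effect, i0, i1, i3]
    intro σ₂ hR2 hC2 hc2 j10 hinput hpow
    have j0 : σ₂.ireg 0 = n := by rw [hR2 0 (by decide)]; simp [Instr.effect, i0]
    have j1 : σ₂.ireg 1 = w := by rw [hR2 1 (by decide)]; simp [Instr.effect, i1]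
    have j2 : σ₂.ireg 2 = 0 := by rw [hR2 2 (by decide)]; simp [Instr.effect, i2]
    have j3 : σ₂.ireg 3 = 1 := by rw [hR2 3 (by decide)]; simp [Instr.effect, i3]
    have j4 : σ₂.ireg 4 = c := by rw [hR2 4 (by decide)]; simp [Instr.effect, i4]
    have j5 : σ₂.ireg 5 = c + 1 := by rw [hR2 5 (by decide)]; simp [Instr.effect, i3, i4]
    have j9 : σ₂.ireg 9 = n + w + 1 := by
      rw [hR2 9 (by decide)]; simp [Instr.effect, i0, i1, i3]
    replace hC2 : σ₂.creg 5 = 1 := by rw [hC2]; exact c5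
    replace hc2 : σ₂.cmem = (inputMem n w s A).cmem := hc2.trans hc1
    clear hR2
    refine Runs.seq (Runs.ops rfl (Runs.seq ((runs_mulAdd (a := 10) (k := 8) (d := 11) ?_ ?_
      (by decide) (by decide) (by decide) (by decide) (by decide) (by decide) (by decide) ?_).mono
      (T' := (c + 1) * 4 + 2) ?_ fun _ h => h)))
    · simp [Instr.effect, j2]
    · simp [Instr.effect, j3]
    swap
    · simp [Instr.effect, j2, j5]
    refine Runs.seq (Runs.ops rfl (Runs.seq ((runs_mulAdd (a := 0) (k := 8) (d := 12) ?_ ?_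
      (by decide) (by decide) (by decide) (by decide) (by decide) (by decide) (by decide) ?_).mono
      (T' := n * 4 + 2) ?_ fun _ h => h)))
    · simp [Instr.effect, j2]
    · simp [Instr.effect, j3]
    swap
    · simp [Instr.effect, j2, j0]
    refine Runs.ops rfl (hQ _ ?_ ?_ ?_ ?_ ?_)
    · constructor <;> try simp [Instr.effect, *]
      · ring
      · exact hpow
      · exact hinput
    · simp [Instr.effect, j0, j2]
    · simp [Instr.effect, j0, j2]
      ring
    · simp [Instr.effect, j0, j2]
    · simp [Instr.effect, j0, j2, hc2, hC2]
  refine key.mono ?_ fun _ h => h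
  omega

theorem runs_readOff {σ : Mem} (hσ : Ready w c s σ) (hs : ∀ v, extend s v < c + 1)
    {Q : Mem → Prop}
    (hQ : ∀ σ', σ'.creg 0 = σ.cmem (σ.ireg 12 +
      ∑ e ∈ Finset.range (w + 1), extend s e * (c + 1) ^ e) → Q σ') :
    Runs readOff σ ((w + 1) * (4 * c + 8) + 6) Q := by
  have key : Runs readOff σ (3 + ((w + 1) * (3 + (c * 4 + 2 + 1) + 2) + 2 + 1)) Q := by
    refine Runs.seq (Runs.ops rfl (Runs.seq ((Runs.loop (fun m σ' => ∃ k, k + m = w + 1 ∧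
      Agree [6, 7, 8, 10, 15, 16] [] σ σ' ∧ σ'.cmem = σ.cmem ∧ σ'.ireg 16 = w + 1 ∧
      σ'.ireg 6 = k ∧ σ'.ireg 15 = σ.ireg 12 + ∑ e ∈ Finset.range k, extend s e * (c + 1) ^ e)
      (T := 3 + (c * 4 + 2 + 1)) ?_ ?_ (k := w + 1) ?_).mono le_rfl ?_)))
    · rintro σ' ⟨k, hk, _, _, h16, h6, _⟩
      rw [h16, h6, ← hk]
      simp
    · rintro m σ' ⟨k, hk, hAg, hc, h16, h6, h15⟩
      have i9 := (hAg.ireg 9 (by decide)).trans hσ.r9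
      have i2 := (hAg.ireg 2 (by decide)).trans hσ.r2
      have i3 := (hAg.ireg 3 (by decide)).trans hσ.r3
      have hp := hσ.pow k (by omega)
      have hi := hσ.input k (by omega)
      rw [← hAg.imem] at hp hi
      refine ⟨by rw [h16, h6]; omega, Runs.seq (Runs.ops rfl (Runs.seq
        ((runs_mulAdd (a := 10) (k := 8) (d := 15) ?_ ?_ (by decide) (by decide) (by decide)
        (by decide) (by decide) (by decide) (by decide) ?_).mono
        (T' := c * 4 + 2) ?_ fun _ h => h)))⟩
      · simp [Instr.effect, i2]
      · simp [Instr.effect, i3]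
      · refine Runs.ops rfl ⟨k + 1, by omega, ⟨?_, hAg.creg, hAg.imem⟩, hc, ?_, ?_, ?_⟩
        · intro r hr
          rw [← hAg.ireg r hr]
          simp only [List.mem_cons, List.not_mem_nil, or_false, not_or] at hr
          simp [Instr.effect, hr]
        · simp [Instr.effect, h16]
        · simp [Instr.effect, h6, i3]
        · rw [Finset.sum_range_succ, ← add_assoc, ← h15]
          simp [Instr.effect, h6, i9, hp, hi, mul_comm]
      · have := hs k
        simp [Instr.effect, h6, hi]
        omega
    · refine ⟨0, by omega, ⟨?_, fun _ _ => rfl, rfl⟩, rfl, ?_, ?_, ?_⟩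
      · intro r hr
        simp only [List.mem_cons, List.not_mem_nil, or_false, not_or] at hr
        simp [Instr.effect, hr]
      · simp [Instr.effect, hσ.r1, hσ.r3]
      · simp [Instr.effect]
      · simp [Instr.effect, hσ.r2]
    · rintro σ' ⟨k, hk, _, hc, _, _, h15⟩
      rw [Nat.add_zero] at hk
      subst hk
      refine Runs.ops rfl (hQ _ ?_)
      simp [Instr.effect, hc, h15]
  refine key.mono ?_ fun _ h => h
  ring_nf; omega

/-- A bound for the time that `lhafProgram` takes. -/
def lhafTime (n w c : ℕ) : ℕ :=
  (10 * n + w * (4 * c + 14) + 4 * c + 29) + ((n * (4 * c + 14 + rowTime w c) + 2) +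
    ((w + 1) * (4 * c + 8) + 6))

theorem runs_lhafProgram (hA : A.IsSymm) (hband : IsBanded A w) (hc : c = Finset.univ.sup s) :
    Runs lhafProgram (inputMem n w s A) (lhafTime n w c) fun σ =>
      σ.creg 0 = lhaf (repeated A s) (repeated_isSymm hA s) := by
  refine Runs.seq (runs_setup hc fun σ hσ h12 h13 h14 hM => Runs.seq ?_)
  refine runs_tableLoop (A := A) (hA := hA) hσ hband (extend_lt hc) h12 h13 h14 ?_ ?_ ?_
  · intro i j
    rw [hM, Function.update_of_ne (entry_lt i j).ne, inputMem_cmem]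
  · intro x hx
    rcases eq_or_ne x 0 with rfl | h0
    · rw [hM, Nat.add_zero (n * n), Function.update_self]
      exact isCell_last
    · exact isCell_last_of_ne_zero hx h0 _
  · intro σ' hσ' hcell
    refine runs_readOff hσ' (extend_lt hc) fun σ'' h => ?_
    rw [h]
    exact (isCell_zero_iff (extend_lt hc)
      (hcell _ (sum_digits_lt (extend_lt hc) (w + 1)))).symm

end Setup

/-! ### The time bound. -/

/-- For `w ≥ 1` the extra factor `c + 1` is absorbed because `w + 2 ≤ 2 * w + 1`; for `w = 0` it is
absent. The remaining factor `w + 1` is at most the logarithm, since the base `2 * c + 2` is at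
least `2`. -/
theorem pow_mul_le (w c : ℕ) : (c + 1) ^ (w + 1) * (1 + w * (c + 1)) ≤
    (2 * c + 2) ^ (2 * w + 1) * Nat.log 2 ((2 * c + 2) ^ (2 * w + 1)) := by
  have hlog : w + 1 ≤ Nat.log 2 ((2 * c + 2) ^ (2 * w + 1)) := by
    refine Nat.le_log_of_pow_le (by norm_num) ?_
    calc 2 ^ (w + 1) ≤ 2 ^ (2 * w + 1) := Nat.pow_le_pow_right (by norm_num) (by omega)
      _ ≤ (2 * c + 2) ^ (2 * w + 1) := Nat.pow_le_pow_left (by omega) _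
  refine le_trans ?_ (Nat.mul_le_mul_left _ hlog)
  have hle : (c + 1) ^ (2 * w + 1) ≤ (2 * c + 2) ^ (2 * w + 1) :=
    Nat.pow_le_pow_left (by omega) _
  refine le_trans ?_ (Nat.mul_le_mul_right _ hle)
  rcases Nat.eq_zero_or_pos w with rfl | hw
  · simp
  · have h1 : (c + 1) ^ (w + 1) ≤ (c + 1) ^ (2 * w + 1) :=
      Nat.pow_le_pow_right (by omega) (by omega)
    have h2 : (c + 1) ^ (w + 1) * (c + 1) ≤ (c + 1) ^ (2 * w + 1) := by
      rw [← pow_succ]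
      exact Nat.pow_le_pow_right (by omega) (by omega)
    calc (c + 1) ^ (w + 1) * (1 + w * (c + 1))
        = (c + 1) ^ (w + 1) + w * ((c + 1) ^ (w + 1) * (c + 1)) := by ring
      _ ≤ (c + 1) ^ (2 * w + 1) + w * (c + 1) ^ (2 * w + 1) :=
        add_le_add h1 (Nat.mul_le_mul_left _ h2)
      _ = _ := by ring

theorem lhafTime_le {n : ℕ} (hn : 0 < n) (w c : ℕ) :
    lhafTime n w c ≤ 200 * (n * ((c + 1) ^ (w + 1) * (1 + w * (c + 1)))) := by
  have hp : 1 ≤ (c + 1) ^ w := Nat.one_le_pow _ _ (by omega)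
  set p := (c + 1) ^ w
  have hrow : rowTime w c ≤ 50 * (p * ((c + 1) * (1 + w * (c + 1)))) := by
    have h1 : c * (w * (4 * c + 16) + 18) + 11 + 2 ≤ 50 * ((c + 1) * (1 + w * (c + 1))) := by
      nlinarith [Nat.zero_le (c * w * c), Nat.zero_le (c * w), Nat.zero_le c, Nat.zero_le w]
    calc rowTime w c = p * (c * (w * (4 * c + 16) + 18) + 11) + 2 := rfl
      _ ≤ p * (c * (w * (4 * c + 16) + 18) + 11 + 2) := by nlinarith
      _ ≤ p * (50 * ((c + 1) * (1 + w * (c + 1)))) := Nat.mul_le_mul_left _ h1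
      _ = _ := by ring
  have hpow : (c + 1) ^ (w + 1) * (1 + w * (c + 1)) = p * ((c + 1) * (1 + w * (c + 1))) := by
    rw [pow_succ, mul_assoc]
  rw [hpow]
  set X := (c + 1) * (1 + w * (c + 1)) with hX
  have hX1 : w * c + w + c + 1 ≤ X := by
    rw [hX]
    nlinarith [Nat.zero_le (c * w * c), Nat.zero_le (c * w)]
  have hY : X ≤ p * X := Nat.le_mul_of_pos_left _ hp
  have hZ : p * X ≤ n * (p * X) := Nat.le_mul_of_pos_left _ hn
  -- Here `64 = 14 + 50`: the overhead `4 * c + 14` is at most `14 * X`, and `hrow` supplies the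
  -- `50`.
  have hmid : n * (4 * c + 14 + rowTime w c) ≤ n * (64 * (p * X)) :=
    Nat.mul_le_mul_left _ (by omega)
  have hn' : n ≤ n * (p * X) := Nat.le_mul_of_pos_right _ (by omega)
  have e1 : w * (4 * c + 14) = 4 * (w * c) + 14 * w := by ring
  have e2 : (w + 1) * (4 * c + 8) = 4 * (w * c) + 8 * w + 4 * c + 8 := by ring
  have e3 : n * (64 * (p * X)) = 64 * (n * (p * X)) := by ring
  rw [lhafTime, e1, e2]
  rw [e3] at hmid
  omega

end LoopHaf

/-- A single program computes `lhaf(A_s)` in time `O*(n (2c+2)^(2w+1))` with `c = max s_i`; the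
factor that `O*` hides is polylogarithmic in `(2c+2)^(2w+1)`, that is, polynomial in `w` and
`log c`. -/
theorem mainTheorem3 :
    ∃ (P : LoopHaf.Program) (K k : ℕ),
      ∀ (n w c : ℕ) (A : Matrix (Fin n) (Fin n) ℂ) (s : Fin n → ℕ) (hA : A.IsSymm),
        0 < n → LoopHaf.IsBanded A w → (∀ i, 0 < s i) → c = Finset.univ.sup s →
        ∃ t : ℕ,
          t ≤ K * (n * (2 * c + 2) ^ (2 * w + 1)) * Nat.log 2 ((2 * c + 2) ^ (2 * w + 1)) ^ k ∧
          LoopHaf.HaltsWith P (LoopHaf.inputConfig n w s A) t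
            (LoopHaf.lhaf (LoopHaf.repeated A s) (LoopHaf.repeated_isSymm hA s)) := by
  -- `200` comes from `lhafTime_le`, and the single logarithm from `pow_mul_le`.
  refine ⟨LoopHaf.lhafProgram.compile 0, 200, 1, ?_⟩
  intro n w c A s hA hn hband _ hc
  obtain ⟨t, ht, h⟩ := (LoopHaf.runs_lhafProgram hA hband hc).haltsWith
  refine ⟨t, ht.trans ((LoopHaf.lhafTime_le hn w c).trans ?_), h⟩
  rw [pow_one, mul_assoc, mul_assoc]
  exact Nat.mul_le_mul_left _ (Nat.mul_le_mul_left _ (LoopHaf.pow_mul_le w c))
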